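/- A \emph{unified chain graph} (UCG) $G$ over a finite node set $V$ has undirected edges $a - b$, solid directed edges $a \to b$ and dashed directed edges $a \dashrightarrow b$, at most one edge between any two nodes and no edge from a node to itself. Moreover, $G$ has no semidirected cycle (no closed walk whose first edge is $\to$ or $\dashrightarrow$ traversed forwards and whose other edges are $-$, or $\to$, $\dashrightarrow$ traversed forwards). The chain components $K \in Cc(G)$ are the maximal sets of nodes connected by undirected edges. Write $Fa(X)$, $Mo(X)$, $Ne(X)$ for the sets of nodes $b$ with $b \to a$, $b \dashrightarrow a$, $b - a$ in $G$, respectively, for some $a \in X$, and $Pa(X) = Fa(X) \cup Mo(X)$; it is required that $Fa(K) \cap Mo(K) = \emptyset$ for every $K \in Cc(G)$. A \emph{route} is a sequence of (not necessarily distinct) nodes in which consecutive nodes are adjacent in $G$; the notions below refer to occurrences of nodes in the route, and subroutes may be read in both directions. An occurrence of $C$ is a \emph{collider node} if it is the middle of a subroute $A \dashrightarrow C \dashleftarrow B$, $A \dashrightarrow C - B$ or $A \dashrightarrow C \leftarrow B$. A maximal undirected subroute $C_1 - \cdots - C_n$ ($n \ge 1$) is a \emph{collider section} if $A \to C_1 -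 \cdots - C_n \leftarrow B$ is a subroute. The route is \emph{$Z$-open} if (i) all its collider nodes are in $Z$, (ii) each of its collider sections has some node in $Z$, and (iii) every occurrence that is neither a collider node nor in a collider section is outside $Z$. For pairwise disjoint $X, Y, Z \subseteq V$, write $X \perp_G Y \mid Z$ if there is no $Z$-open route between a node in $X$ and a node in $Y$. A distribution $p$ of a random vector indexed by $V$ satisfies the \emph{global Markov property} with respect to $G$ if, for all pairwise disjoint $X, Y, Z \subseteq V$, $X \perp_G Y \mid Z$ implies that $X$ and $Y$ are conditionally independent given $Z$ under $p$. \textbf{Theorem.} Let $G$ be a UCG over $V$ and let $p$ be a Gaussian distribution on $\mathbb{R}^V$ with positive definite covariance matrix $\Sigma$. For $K \in Cc(G)$ let $$\beta_K = \Sigma_{K,Pa(K)} \Sigma_{Pa(K),Pa(K)}^{-1}, \qquad \Lambda_K = \Sigma_{K,K} - \Sigma_{K,Pa(K)} \Sigma_{Pa(K),Pa(K)}^{-1} \Sigma_{Pa(K),K},$$ which are the matrix of coefficients of the conditional mean and the covariance matrix of $p(K \mid Pa(K))$, and let $\Omega$ denote the precision matrix (inverse covariance matrix) of the marginal $p(K,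 Pa(K))$. Then $p$ satisfies $$p(V) = \prod_{K \in Cc(G)} p(K \mid Pa(K)) \qquad (1)$$ (as an identity between densities, almost everywhere) and, for every $K \in Cc(G)$, $$(\beta_K)_{i,j} = 0 \ \text{ for all } i \in K,\ j \in Mo(K) \setminus Mo(i),$$ $$\Omega_{i,j} = 0 \ \text{ for all } i \in K,\ j \in Fa(K) \setminus Fa(i),$$ $$(\Lambda_K^{-1})_{i,j} = 0 \ \text{ for all } i, j \in K \text{ with } j \ne i,\ j \notin Ne(i),$$ if and only if $p$ satisfies the global Markov property with respect to $G$. -/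

import Mathlib

open MeasureTheory ProbabilityTheory

/-- A unified chain graph (UCG) on the node set `V`: undirected edges `a - b` (`und`), solid directed
edges `a → b` (`solid a b`) and dashed directed edges `a ⇢ b` (`dashed a b`), with at most one edge
between two nodes, without semidirected cycles, and such that no node is at the same time a father
and a mother of the same chain component. -/
structure UCG (V : Type*) where
  /-- undirected edges `a - b` -/
  und : SimpleGraph V
  /-- solid directed edges `a → b` -/
  solid : V → V → Prop
  /-- dashed directed edges `a ⇢ b` -/
  dashed : V → V → Prop
  /-- At most one edge between two nodes: the remaining cases (two directed edges of opposite
  directions, or a directed and an undirected edge) are excluded by `no_semidirected_cycle`. -/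
  not_solid_and_dashed : ∀ a b, ¬ (solid a b ∧ dashed a b)
  /-- There is no cycle `a → b ⊸ ⋯ ⊸ a` or `a ⇢ b ⊸ ⋯ ⊸ a`, where `⊸` is any of `→`, `⇢`, `-`. -/
  no_semidirected_cycle : ∀ a b, (solid a b ∨ dashed a b) →
    ¬ Relation.ReflTransGen (fun c d => solid c d ∨ dashed c d ∨ und.Adj c d) b a
  /-- If `a` is a father of `b`, then it is a mother of no `c` in the chain component of `b`. -/
  fathers_disjoint_mothers : ∀ a b c, und.Reachable b c → solid a b → ¬ dashed a c

namespace UCG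

variable {V : Type*} (G : UCG V)

section Families

variable [Fintype V] [DecidableEq V]

open Classical in
/-- Fathers of a set of nodes. -/
noncomputable def Fa (X : Finset V) : Finset V := Finset.univ.filter fun b => ∃ a ∈ X, G.solid b a

open Classical in
/-- Mothers of a set of nodes. -/
noncomputable def Mo (X : Finset V) : Finset V := Finset.univ.filter fun b => ∃ a ∈ X, G.dashed b a

open Classical in
/-- Neighbours of a set of nodes. -/
noncomputable def Ne (X : Finset V) : Finset V := Finset.univ.filter fun b => ∃ a ∈ X, G.und.Adj b a

/-- Parents of a set of nodes: its fathers and its mothers. -/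
noncomputable def Pa (X : Finset V) : Finset V := G.Fa X ∪ G.Mo X

open Classical in
/-- The chain components: the maximal sets of nodes that are connected by undirected routes. -/
noncomputable def Cc : Finset (Finset V) :=
  Finset.univ.image fun v => Finset.univ.filter fun w => G.und.Reachable v w

end Families

/-- Adjacency by an edge of any type, in any direction. -/
def Adjacent (a b : V) : Prop :=
  G.solid a b ∨ G.solid b a ∨ G.dashed a b ∨ G.dashed b a ∨ G.und.Adj a b

/-- `r 0, …, r n` is a route: consecutive nodes are adjacent (nodes may be repeated; the values of
`r` beyond `n` play no role). -/
def IsRoute (n : ℕ) (r : ℕ → V) : Prop :=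
  ∀ i < n, G.Adjacent (r i) (r (i + 1))

/-- `a, c, b` is of the form `a ⇢ c ⇠ b` or `a ⇢ c - b` or `a ⇢ c ← b`. -/
def ColliderTriple (a c b : V) : Prop :=
  G.dashed a c ∧ (G.dashed b c ∨ G.und.Adj c b ∨ G.solid b c)

/-- The occurrence of a node at position `i` of the route `r 0, …, r n` is a collider node.
Subroutes may be read in both directions. -/
def IsColliderNode (n : ℕ) (r : ℕ → V) (i : ℕ) : Prop :=
  1 ≤ i ∧ i + 1 ≤ n ∧
    (G.ColliderTriple (r (i - 1)) (r i) (r (i + 1)) ∨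
      G.ColliderTriple (r (i + 1)) (r i) (r (i - 1)))

/-- Positions `j, …, k` of the route `r 0, …, r n` form a collider section
`r (j - 1) → r j - ⋯ - r k ← r (k + 1)`. Such an undirected subroute is maximal, since the route
continues by directed edges at both ends. -/
def IsColliderSection (n : ℕ) (r : ℕ → V) (j k : ℕ) : Prop :=
  1 ≤ j ∧ j ≤ k ∧ k + 1 ≤ n ∧ (∀ i, j ≤ i → i < k → G.und.Adj (r i) (r (i + 1))) ∧
    G.solid (r (j - 1)) (r j) ∧ G.solid (r (k + 1)) (r k)

/-- The route `r 0, …, r n` is `Z`-open. -/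
def IsOpen (Z : Finset V) (n : ℕ) (r : ℕ → V) : Prop :=
  (∀ i, G.IsColliderNode n r i → r i ∈ Z) ∧
  (∀ j k, G.IsColliderSection n r j k → ∃ i, j ≤ i ∧ i ≤ k ∧ r i ∈ Z) ∧
  (∀ i ≤ n, ¬ G.IsColliderNode n r i →
    (¬ ∃ j k, G.IsColliderSection n r j k ∧ j ≤ i ∧ i ≤ k) → r i ∉ Z)

/-- `X` is separated from `Y` given `Z`: there is no `Z`-open route between `X` and `Y`. -/
def Separated (X Y Z : Finset V) : Prop :=
  ¬ ∃ (n : ℕ) (r : ℕ → V), G.IsRoute n r ∧ r 0 ∈ X ∧ r n ∈ Y ∧ G.IsOpen Z n r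

end UCG

section Distribution

variable {V : Type*} [Fintype V]

/-- Under the law `p` on `V → ℝ`, the coordinates in `X` and those in `Y` are conditionally
independent given (the σ-algebra generated by) the coordinates in `Z`. -/
def CondIndepCoords (p : Measure (V → ℝ)) [IsFiniteMeasure p] (X Y Z : Finset V) : Prop :=
  CondIndepFun (MeasurableSpace.comap (Z.restrict (π := fun _ : V => ℝ)) inferInstance)
    (Finset.measurable_restrict Z).comap_le
    (X.restrict (π := fun _ : V => ℝ)) (Y.restrict (π := fun _ : V => ℝ)) p

/-- The global Markov property of `p` with respect to the UCG `G`. -/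
def GlobalMarkov (p : Measure (V → ℝ)) [IsFiniteMeasure p] (G : UCG V) : Prop :=
  ∀ X Y Z : Finset V, Disjoint X Y → Disjoint X Z → Disjoint Y Z →
    G.Separated X Y Z → CondIndepCoords p X Y Z

/-- The density of the marginal of `p` on the coordinates in `A`, evaluated at the
`A`-coordinates of `x`. -/
noncomputable def margDensity (p : Measure (V → ℝ)) (A : Finset V) (x : V → ℝ) : ENNReal :=
  (p.map (A.restrict (π := fun _ : V => ℝ))).rnDeriv volume (A.restrict x)

/-- The covariance matrix of `p`. -/
noncomputable def covMat (p : Measure (V → ℝ)) : Matrix V V ℝ :=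
  Matrix.of fun i j => cov[fun x => x i, fun x => x j; p]

/-- The block `Σ_{A,B}` of the covariance matrix of `p`. -/
noncomputable def covBlock (p : Measure (V → ℝ)) (A B : Finset V) : Matrix A B ℝ :=
  (covMat p).submatrix (fun i => (i : V)) (fun j => (j : V))

variable [DecidableEq V]

/-- The conditional density `p(A | B)`, evaluated at the corresponding coordinates of `x`. -/
noncomputable def condDensity (p : Measure (V → ℝ)) (A B : Finset V) (x : V → ℝ) : ENNReal :=
  margDensity p (A ∪ B) x / margDensity p B x

/-- The factorization `p(V) = ∏_K p(K | Pa(K))` over the chain components `K` of `G`, as an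
identity of Lebesgue densities. -/
def Factorizes (p : Measure (V → ℝ)) (G : UCG V) : Prop :=
  p.rnDeriv volume =ᵐ[volume] fun x => ∏ K ∈ G.Cc, condDensity p K (G.Pa K) x

/-- The matrix of the coefficients of the (affine) conditional mean of `K` given `P`:
`β = Σ_{K,P} Σ_{P,P}⁻¹`. -/
noncomputable def regCoef (p : Measure (V → ℝ)) (K P : Finset V) : Matrix K P ℝ :=
  covBlock p K P * (covBlock p P P)⁻¹

/-- The covariance matrix of the conditional distribution of `K` given `P`:
`Λ = Σ_{K,K} - Σ_{K,P} Σ_{P,P}⁻¹ Σ_{P,K}`. -/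
noncomputable def condCov (p : Measure (V → ℝ)) (K P : Finset V) : Matrix K K ℝ :=
  covBlock p K K - covBlock p K P * (covBlock p P P)⁻¹ * covBlock p P K

/-- The precision matrix of the marginal of `p` on the coordinates in `A`. -/
noncomputable def margPrecision (p : Measure (V → ℝ)) (A : Finset V) : Matrix A A ℝ :=
  (covBlock p A A)⁻¹

/-- `(β_K)_{i,j} = 0` for all `i ∈ K` and `j ∈ Mo(K) \ Mo(i)`. -/
def ZeroMothers (p : Measure (V → ℝ)) (G : UCG V) : Prop :=
  ∀ K ∈ G.Cc, ∀ (i : K) (j : G.Pa K), (j : V) ∈ G.Mo K \ G.Mo {(i : V)} →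
    regCoef p K (G.Pa K) i j = 0

/-- `Ω_{i,j} = 0` for all `i ∈ K` and `j ∈ Fa(K) \ Fa(i)`, where `Ω` is the precision matrix of
`p(K, Pa(K))`. -/
def ZeroFathers (p : Measure (V → ℝ)) (G : UCG V) : Prop :=
  ∀ K ∈ G.Cc, ∀ i j : (K ∪ G.Pa K : Finset V), (i : V) ∈ K →
    (j : V) ∈ G.Fa K \ G.Fa {(i : V)} → margPrecision p (K ∪ G.Pa K) i j = 0

/-- `(Λ_K⁻¹)_{i,j} = 0` for all distinct `i, j ∈ K` with `j ∉ Ne(i)`. -/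
def ZeroNeighbours (p : Measure (V → ℝ)) (G : UCG V) : Prop :=
  ∀ K ∈ G.Cc, ∀ i j : K, i ≠ j → (j : V) ∈ K \ G.Ne {(i : V)} →
    (condCov p K (G.Pa K))⁻¹ i j = 0

end Distribution

/-!
Let `β` and `φ` collect the coefficients of the mothers and of the fathers in the regressions of
the chain components on their parents, let `R = 1 - β - φ`, and let `M` be the block diagonal
matrix with the blocks `Λ_K⁻¹`. Since the parents of a chain component precede it, `det R = 1`,
and comparing Gaussian densities shows that the factorization holds if and only if `R Σ Rᵀ`, whose
diagonal blocks are the `Λ_K`, is block diagonal. The zeros of `β`, of the precision matrices `Ω`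
and of `M` say that `β`, `S = M φ` and `M` are supported on the dashed, solid and undirected
edges, respectively.

If `p` is Markov, each of these zeros, in `R Σ Rᵀ` or in a coefficient matrix, comes from one
separation in `G`, because conditional independence given `Z` means that the residual of one
coordinate after regression on `Z` is uncorrelated with the other coordinate.

Conversely, let `a` be the vector of coefficients of the residual of the coordinate `x` given `Z`.
The factorization says that `T Σ Tᵀ = M` for `T = M (1 - β) - S`. Thus `a = Tᵀ l`, where
`M l = T b` and `b = Σ a`. Together with `b = 0` on `Z` and `a = 1_x` off `Z`, and with auxiliary
unknowns for `(1 - β) b`, `T b` and `M⁻¹ S b`, this is a square linear system with an injective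
operator.
One can choose the equations so that an unknown at one node occurs in an equation at another only
along an edge that can extend a `Z`-open route. The operator then maps the subspace of the vectors
supported on the unknowns reachable from `x` into itself, hence onto itself, so the solution
vanishes at all other unknowns. In particular `b y = 0` if no `Z`-open route leads from `x` to
`y`.
-/

section GaussianDensity

open Matrix
open scoped ENNReal MatrixOrder

theorem eq_withDensity_of_map_eq_withDensity {E : Type*} [NormedAddCommGroup E] [NormedSpace ℝ E]
    [FiniteDimensional ℝ E] [MeasurableSpace E] [BorelSpace E] {μ ν : Measure E}
    [μ.IsAddHaarMeasure] {f : E → E} {f' : E → E →L[ℝ] E} {g : E → ℝ≥0∞}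
    (hf' : ∀ x, HasFDerivAt f (f' x) x) (hf : Function.Injective f)
    (hν : ν.map f = μ.withDensity g) :
    ν = μ.withDensity fun x => ENNReal.ofReal |(f' x).det| * g (f x) := by
  have hcont : Continuous f := continuous_iff_continuousAt.2 fun x => (hf' x).continuousAt
  have hemb : MeasurableEmbedding f := hcont.measurableEmbedding hf
  ext s hs
  rw [← Set.preimage_image_eq s hf, ← hemb.map_apply, hν,
    withDensity_apply _ (hemb.measurableSet_image' hs), Set.preimage_image_eq s hf,
    withDensity_apply _ hs]
  exact lintegral_image_eq_lintegral_abs_det_fderiv_mul μ hs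
    (fun x _ => (hf' x).hasFDerivWithinAt) hf.injOn g

variable {ι : Type*}

theorem memLp_eval_of_isGaussian (ν : Measure (ι → ℝ)) [IsGaussian ν] (i : ι) :
    MemLp (fun x : ι → ℝ => x i) 2 ν :=
  have h : HasGaussianLaw (fun x : ι → ℝ => (fun j => x j)) ν := IsGaussian.hasGaussianLaw_id
  (h.eval (X := fun j (x : ι → ℝ) => x j) i).memLp_two

theorem covMat_transpose (ν : Measure (ι → ℝ)) : (covMat ν)ᵀ = covMat ν :=
  Matrix.ext fun _ _ => covariance_comm _ _

variable [Fintype ι]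

section LinearFunctionals

variable (ν : Measure (ι → ℝ)) [IsGaussian ν]

theorem integrable_dotProduct (a : ι → ℝ) : Integrable (fun x => a ⬝ᵥ x) ν :=
  integrable_finsetSum _ fun i _ =>
    ((memLp_eval_of_isGaussian ν i).integrable one_le_two).const_mul (a i)

theorem integral_dotProduct (a : ι → ℝ) : ∫ x, a ⬝ᵥ x ∂ν = a ⬝ᵥ fun i => ∫ x, x i ∂ν := by
  simp only [dotProduct]
  rw [integral_finsetSum _ fun i _ =>
    ((memLp_eval_of_isGaussian ν i).integrable one_le_two).const_mul (a i)]
  simp only [integral_const_mul]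

theorem covariance_dotProduct (a b : ι → ℝ) :
    cov[fun x => a ⬝ᵥ x, fun x => b ⬝ᵥ x; ν] = a ⬝ᵥ covMat ν *ᵥ b := by
  simp only [dotProduct, mulVec]
  rw [covariance_fun_sum_fun_sum (fun i => (memLp_eval_of_isGaussian ν i).const_mul _)
    (fun i => (memLp_eval_of_isGaussian ν i).const_mul _)]
  refine Finset.sum_congr rfl fun i _ => ?_
  rw [Finset.mul_sum]
  refine Finset.sum_congr rfl fun j _ => ?_
  rw [covariance_const_mul_left, covariance_const_mul_right, covMat, of_apply]
  ring

end LinearFunctionals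

theorem pi_gaussianReal_eq_withDensity :
    Measure.pi (fun _ : ι => gaussianReal 0 1) =
      volume.withDensity fun x => ENNReal.ofReal (∏ i, gaussianPDFReal 0 1 (x i)) := by
  refine Measure.pi_eq fun s hs => ?_
  have hindicator : (Set.univ.pi s).indicator (fun x : ι → ℝ => ∏ i, gaussianPDFReal 0 1 (x i)) =
      fun x => ∏ i, (s i).indicator (gaussianPDFReal 0 1) (x i) := by
    classical
    ext x
    simp only [Set.indicator_apply, Set.mem_univ_pi]
    split_ifs with h
    · exact Finset.prod_congr rfl fun i _ => (if_pos (h i)).symm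
    · obtain ⟨i, hi⟩ := not_forall.1 h
      exact (Finset.prod_eq_zero (Finset.mem_univ i) (if_neg hi)).symm
  have hint : Integrable fun x : ι → ℝ => ∏ i, gaussianPDFReal 0 1 (x i) :=
    Integrable.fintype_prod (f := fun _ => gaussianPDFReal 0 1)
      fun _ => integrable_gaussianPDFReal 0 1
  rw [withDensity_apply _ (MeasurableSet.univ_pi hs),
    ← ofReal_integral_eq_lintegral_ofReal hint.integrableOn
      (.of_forall fun x => Finset.prod_nonneg fun i _ => gaussianPDFReal_nonneg 0 1 (x i)),
    ← integral_indicator (MeasurableSet.univ_pi hs), hindicator,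
    integral_fintype_prod_volume_eq_prod (fun i => (s i).indicator (gaussianPDFReal 0 1)),
    ENNReal.ofReal_prod_of_nonneg fun i _ => integral_nonneg fun x =>
      Set.indicator_nonneg (fun y _ => gaussianPDFReal_nonneg 0 1 y) x]
  refine Finset.prod_congr rfl fun i _ => ?_
  rw [integral_indicator (hs i), gaussianReal_apply_eq_integral 0 one_ne_zero]

theorem prod_gaussianPDFReal (z : ι → ℝ) :
    ∏ i, gaussianPDFReal 0 1 (z i) =
      (√(2 * Real.pi) ^ Fintype.card ι)⁻¹ * Real.exp (-(z ⬝ᵥ z) / 2) := by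
  simp only [gaussianPDFReal, Finset.prod_mul_distrib, ← Real.exp_sum]
  simp [dotProduct, Finset.sum_div, sq, Finset.sum_neg_distrib, neg_div, mul_pow, mul_comm]

variable [DecidableEq ι]

/-- The density of the nondegenerate Gaussian distribution with mean `m` and covariance
matrix `S`. -/
noncomputable def gaussianDensity (m : ι → ℝ) (S : Matrix ι ι ℝ) (x : ι → ℝ) : ℝ :=
  (√(2 * Real.pi) ^ Fintype.card ι * √S.det)⁻¹ * Real.exp (-((x - m) ⬝ᵥ S⁻¹ *ᵥ (x - m)) / 2)

theorem continuous_gaussianDensity (m : ι → ℝ) (S : Matrix ι ι ℝ) :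
    Continuous (gaussianDensity m S) := by
  unfold gaussianDensity
  simp only [dotProduct, mulVec]
  fun_prop

theorem gaussianDensity_pos (m : ι → ℝ) {S : Matrix ι ι ℝ} (hS : S.PosDef) (x : ι → ℝ) :
    0 < gaussianDensity m S x := by
  have := Real.sqrt_pos.2 hS.det_pos
  unfold gaussianDensity
  positivity

theorem exists_inv_eq_transpose_mul_self {S : Matrix ι ι ℝ} (hS : S.PosDef) :
    ∃ A : Matrix ι ι ℝ, S⁻¹ = Aᵀ * A ∧ A * S * Aᵀ = 1 := by
  obtain ⟨A, hA⟩ : ∃ A : Matrix ι ι ℝ, S⁻¹ = Aᵀ * A :=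
    CStarAlgebra.nonneg_iff_eq_star_mul_self.1 hS.inv.posSemidef.nonneg
  have hleft : Aᵀ * (A * S) = 1 := by
    rw [← Matrix.mul_assoc, ← hA, nonsing_inv_mul _ hS.det_pos.ne'.isUnit]
  exact ⟨A, hA, mul_eq_one_comm.1 hleft⟩

theorem abs_det_of_inv_eq_transpose_mul_self {S A : Matrix ι ι ℝ} (hA : S⁻¹ = Aᵀ * A) :
    |A.det| = (√S.det)⁻¹ := by
  have hdet : S.det⁻¹ = A.det ^ 2 := by
    rw [← Ring.inverse_eq_inv', ← det_nonsing_inv, hA, det_mul, det_transpose, sq]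
  rw [← Real.sqrt_inv, hdet, Real.sqrt_sq_eq_abs]

theorem map_whitening_eq_pi (ν : Measure (ι → ℝ)) [IsGaussian ν] {A : Matrix ι ι ℝ}
    (hA : A * covMat ν * Aᵀ = 1) :
    ν.map (fun x => A *ᵥ (x - fun i => ∫ y, y i ∂ν)) =
      Measure.pi fun _ : ι => gaussianReal 0 1 := by
  set m : ι → ℝ := fun i => ∫ y, y i ∂ν
  have hlaw : HasGaussianLaw (fun x : ι → ℝ => A *ᵥ (x - m)) ν :=
    have hsub : HasGaussianLaw (fun x : ι → ℝ => x - m) ν :=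
      ⟨inferInstanceAs (IsGaussian (ν.map fun x => x - m))⟩
    hsub.map_fun (Matrix.toLin' A).toContinuousLinearMap
  have hrow : ∀ i, (fun x : ι → ℝ => (A *ᵥ (x - m)) i) = fun x => A i ⬝ᵥ x - A i ⬝ᵥ m :=
    fun i => funext fun x => dotProduct_sub (A i) x m
  have hmean : ∀ i, ∫ x, (A *ᵥ (x - m)) i ∂ν = 0 := fun i => by
    rw [hrow, integral_sub (integrable_dotProduct ν _) (integrable_const _), integral_dotProduct]
    simp [m]
  have hcov : ∀ i j, cov[fun x : ι → ℝ => (A *ᵥ (x - m)) i, fun x => (A *ᵥ (x - m)) j; ν] =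
      (1 : Matrix ι ι ℝ) i j := fun i j => by
    rw [hrow, hrow, covariance_sub_const_left (integrable_dotProduct ν _),
      covariance_sub_const_right (integrable_dotProduct ν _), covariance_dotProduct, ← hA,
      Matrix.mul_assoc]
    rfl
  have hindep : iIndepFun (fun i (x : ι → ℝ) => (A *ᵥ (x - m)) i) ν :=
    hlaw.iIndepFun_of_covariance_eq_zero fun i j hij => by rw [hcov, one_apply_ne hij]
  rw [(iIndepFun_iff_map_fun_eq_pi_map fun i => (hlaw.eval i).aemeasurable).1 hindep]
  congr 1 with i : 1
  rw [(hlaw.eval i).map_eq_gaussianReal, hmean, ← covariance_self (hlaw.eval i).aemeasurable, hcov]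
  simp

theorem isGaussian_eq_withDensity (ν : Measure (ι → ℝ)) [IsGaussian ν]
    (hν : (covMat ν).PosDef) :
    ν = volume.withDensity fun x =>
      ENNReal.ofReal (gaussianDensity (fun i => ∫ y, y i ∂ν) (covMat ν) x) := by
  set m : ι → ℝ := fun i => ∫ y, y i ∂ν
  obtain ⟨A, hinv, hone⟩ := exists_inv_eq_transpose_mul_self hν
  have hunit : IsUnit A := IsUnit.of_mul_eq_one (covMat ν * Aᵀ) (by rw [← Matrix.mul_assoc, hone])
  have hderiv : ∀ x, HasFDerivAt (fun x => A *ᵥ (x - m)) (toLin' A).toContinuousLinearMap x :=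
    fun x => (toLin' A).toContinuousLinearMap.hasFDerivAt.comp x ((hasFDerivAt_id x).sub_const m)
  have hinj : Function.Injective fun x => A *ᵥ (x - m) :=
    (mulVec_injective_iff_isUnit.2 hunit).comp (sub_left_injective (b := m))
  have hquad : ∀ z : ι → ℝ, (A *ᵥ z) ⬝ᵥ (A *ᵥ z) = z ⬝ᵥ (covMat ν)⁻¹ *ᵥ z := fun z => by
    rw [hinv, ← mulVec_mulVec, dotProduct_mulVec z Aᵀ, vecMul_transpose]
  refine (eq_withDensity_of_map_eq_withDensity hderiv hinj
    ((map_whitening_eq_pi ν hone).trans pi_gaussianReal_eq_withDensity)).trans ?_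
  congr 1 with x
  have hdet : (toLin' A).toContinuousLinearMap.det = A.det := LinearMap.det_toLin' A
  rw [hdet, prod_gaussianPDFReal, hquad, ← ENNReal.ofReal_mul (abs_nonneg _),
    abs_det_of_inv_eq_transpose_mul_self hinv, gaussianDensity, mul_inv, ← mul_assoc,
    mul_comm (√(covMat ν).det)⁻¹]

end GaussianDensity

section CondIndep

variable {Ω β δ ι : Type*} [MeasurableSpace Ω] [MeasurableSpace β] [MeasurableSpace δ]

/-- The kernel that sends `v` to the translate of the measure `ρ` by `ψ v`: the conditional
distribution given `v` of the sum of `ψ v` and a noise with law `ρ`. -/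
noncomputable def translationKernel (ψ : δ → ι → ℝ) (ρ : Measure (ι → ℝ)) : Kernel δ (ι → ℝ) :=
  (Kernel.id ×ₖ Kernel.const δ ρ).map fun p => ψ p.1 + p.2

instance (ψ : δ → ι → ℝ) (ρ : Measure (ι → ℝ)) [IsFiniteMeasure ρ] :
    IsFiniteKernel (translationKernel ψ ρ) := by
  unfold translationKernel
  infer_instance

theorem translationKernel_apply {ψ : δ → ι → ℝ} (hψ : Measurable ψ) (ρ : Measure (ι → ℝ))
    [IsFiniteMeasure ρ] (v : δ) : translationKernel ψ ρ v = ρ.map fun u => ψ v + u := by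
  have hm : Measurable fun p : δ × (ι → ℝ) => ψ p.1 + p.2 := by fun_prop
  rw [translationKernel, Kernel.map_apply _ hm, Kernel.prod_apply, Kernel.id_apply,
    Kernel.const_apply, Measure.dirac_prod, Measure.map_map hm (by fun_prop)]
  rfl

theorem compProd_translationKernel {ψ : δ → ι → ℝ} (hψ : Measurable ψ) (ν : Measure δ)
    [IsFiniteMeasure ν] (ρ : Measure (ι → ℝ)) [IsFiniteMeasure ρ] :
    ν ⊗ₘ translationKernel ψ ρ = (ν.prod ρ).map fun p => (p.1, ψ p.1 + p.2) := by
  ext s hs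
  have hm : Measurable fun p : δ × (ι → ℝ) => (p.1, ψ p.1 + p.2) := by fun_prop
  rw [Measure.compProd_apply hs, Measure.map_apply hm hs, Measure.prod_apply (hm hs)]
  refine lintegral_congr fun v => ?_
  rw [translationKernel_apply hψ, Measure.map_apply (by fun_prop) (measurable_prodMk_left hs)]
  rfl

variable [Finite ι] {μ : Measure Ω} [IsProbabilityMeasure μ]

theorem condDistrib_ae_eq_translationKernel_iff {k : Ω → δ} (hk : Measurable k) {f : Ω → ι → ℝ}
    (hf : Measurable f) {ψ : δ → ι → ℝ} (hψ : Measurable ψ) :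
    condDistrib f k μ =ᵐ[μ.map k] translationKernel ψ (μ.map fun ω => f ω - ψ (k ω)) ↔
      IndepFun k (fun ω => f ω - ψ (k ω)) μ := by
  have hres : Measurable fun ω => f ω - ψ (k ω) := by fun_prop
  have hadd : Measurable fun p : δ × (ι → ℝ) => (p.1, ψ p.1 + p.2) := by fun_prop
  have hsub : Measurable fun p : δ × (ι → ℝ) => (p.1, p.2 - ψ p.1) := by fun_prop
  rw [condDistrib_ae_eq_iff_measure_eq_compProd _ hf.aemeasurable,
    compProd_translationKernel hψ,
    indepFun_iff_map_prod_eq_prod_map_map hk.aemeasurable hres.aemeasurable]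
  constructor
  · intro h
    have hmap := congrArg (Measure.map fun p : δ × (ι → ℝ) => (p.1, p.2 - ψ p.1)) h
    rw [Measure.map_map hsub (by fun_prop), Measure.map_map hsub hadd] at hmap
    simpa [Function.comp_def] using hmap
  · intro h
    rw [← h, Measure.map_map hadd (by fun_prop)]
    simp [Function.comp_def]

theorem condIndepFun_iff_indepFun_sub [StandardBorelSpace Ω] [StandardBorelSpace β] [Nonempty β]
    {k : Ω → δ} (hk : Measurable k) {f : Ω → ι → ℝ} (hf : Measurable f) {g : Ω → β}
    (hg : Measurable g) {φ : δ → ι → ℝ} (hφ : Measurable φ)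
    (hindep : IndepFun k (fun ω => f ω - φ (k ω)) μ) :
    g ⟂ᵢ[k, hk; μ] f ↔ IndepFun (fun ω => (k ω, g ω)) (fun ω => f ω - φ (k ω)) μ := by
  have hkg : Measurable fun ω => (k ω, g ω) := hk.prodMk hg
  have hres : Measurable fun ω => f ω - φ (k ω) := by fun_prop
  have hkernel : (condDistrib f k μ).prodMkRight β =ᵐ[μ.map fun ω => (k ω, g ω)]
      translationKernel (fun p : δ × β => φ p.1) (μ.map fun ω => f ω - φ (k ω)) := by
    have hfst : Measure.QuasiMeasurePreserving Prod.fst (μ.map fun ω => (k ω, g ω)) (μ.map k) := by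
      refine ⟨measurable_fst, ?_⟩
      rw [Measure.map_map measurable_fst hkg]
      exact Measure.AbsolutelyContinuous.rfl
    have := Measure.isProbabilityMeasure_map (μ := μ) hres.aemeasurable
    filter_upwards [hfst.ae ((condDistrib_ae_eq_translationKernel_iff hk hf hφ).2 hindep)]
      with p hp
    rw [Kernel.prodMkRight_apply, hp, translationKernel_apply hφ,
      translationKernel_apply (by fun_prop)]
  rw [condIndepFun_iff_condDistrib_prod_ae_eq_prodMkRight hf hg hk,
    ← condDistrib_ae_eq_translationKernel_iff (ψ := fun p : δ × β => φ p.1) hkg hf (by fun_prop)]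
  exact ⟨fun h => h.trans hkernel, fun h => h.trans hkernel.symm⟩

end CondIndep

section Residual

open Matrix

variable {V : Type*}

theorem posDef_covBlock {p : Measure (V → ℝ)} (hp : (covMat p).PosDef) (A : Finset V) :
    (covBlock p A A).PosDef :=
  hp.submatrix Subtype.val_injective

theorem isUnit_det_covBlock [DecidableEq V] {p : Measure (V → ℝ)} (hp : (covMat p).PosDef)
    (A : Finset V) : IsUnit (covBlock p A A).det :=
  (posDef_covBlock hp A).det_pos.ne'.isUnit

variable [Fintype V]

/-- `a` is the vector of coefficients of the residual of the linear regression of the `i`-th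
coordinate on the coordinates in `Z`, when `S` is the covariance matrix. -/
structure IsResidual (S : Matrix V V ℝ) (Z : Finset V) (i : V) (a : V → ℝ) : Prop where
  apply_self : a i = 1
  apply_eq_zero : ∀ v, v ≠ i → v ∉ Z → a v = 0
  mulVec_eq_zero : ∀ z ∈ Z, (S *ᵥ a) z = 0

theorem eq_zero_of_posDef_of_mulVec_eq_zero_on {S : Matrix V V ℝ} (hS : S.PosDef)
    {A : Set V} {a : V → ℝ} (hsupp : ∀ v ∉ A, a v = 0) (hzero : ∀ v ∈ A, (S *ᵥ a) v = 0) :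
    a = 0 := by
  by_contra ha
  refine (hS.dotProduct_mulVec_pos ha).ne' (Finset.sum_eq_zero fun v _ => ?_)
  by_cases hv : v ∈ A
  · rw [hzero v hv, mul_zero]
  · rw [Pi.star_apply, hsupp v hv, star_zero, zero_mul]

theorem IsResidual.eq {S : Matrix V V ℝ} (hS : S.PosDef) {Z : Finset V} {i : V} {a b : V → ℝ}
    (ha : IsResidual S Z i a) (hb : IsResidual S Z i b) : a = b := by
  rw [← sub_eq_zero]
  refine eq_zero_of_posDef_of_mulVec_eq_zero_on hS (A := Z) (fun v hv => ?_) fun z hz => ?_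
  · by_cases h : v = i
    · rw [h, Pi.sub_apply, ha.apply_self, hb.apply_self, sub_self]
    · rw [Pi.sub_apply, ha.apply_eq_zero v h hv, hb.apply_eq_zero v h hv, sub_self]
  · rw [mulVec_sub, Pi.sub_apply, ha.mulVec_eq_zero z hz, hb.mulVec_eq_zero z hz, sub_self]

theorem IsResidual.dotProduct_eq {S : Matrix V V ℝ} {Z : Finset V} {i : V} {a : V → ℝ}
    (ha : IsResidual S Z i a) (hi : i ∉ Z) (x : V → ℝ) :
    a ⬝ᵥ x = x i + ∑ z : Z, a z * x z := by
  classical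
  have hsupp : ∀ v ∉ insert i Z, a v * x v = 0 := fun v hv => by
    rw [Finset.mem_insert, not_or] at hv
    rw [ha.apply_eq_zero v hv.1 hv.2, zero_mul]
  rw [dotProduct, Finset.sum_coe_sort Z fun z => a z * x z,
    ← Finset.sum_subset (Finset.subset_univ _) fun v _ => hsupp v, Finset.sum_insert hi,
    ha.apply_self, one_mul]

theorem exists_isResidual {S : Matrix V V ℝ} (hS : S.PosDef) {Z : Finset V} {i : V} (hi : i ∉ Z) :
    ∃ a, IsResidual S Z i a := by
  classical
  set R : Matrix Z Z ℝ := S.submatrix (fun z => (z : V)) fun z => (z : V)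
  obtain ⟨c, hc⟩ : ∃ c, R *ᵥ c = fun z : Z => S z i :=
    mulVec_surjective_iff_isUnit.2 (hS.submatrix Subtype.val_injective).isUnit _
  set a : V → ℝ := fun v => if v = i then 1 else if h : v ∈ Z then -c ⟨v, h⟩ else 0
  have hself : a i = 1 := if_pos rfl
  have hother : ∀ v, v ≠ i → v ∉ Z → a v = 0 := fun v h1 h2 => by simp [a, h1, h2]
  have hneg : ∀ z : Z, a z = -c z := fun z => by
    simp [a, show (z : V) ≠ i from fun h => hi (h ▸ z.2)]
  refine ⟨a, hself, hother, fun z hz => ?_⟩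
  have hzero : IsResidual (0 : Matrix V V ℝ) Z i a := ⟨hself, hother, fun z _ => by simp⟩
  have hcz : ∑ w : Z, S z w * c w = S z i := congrFun hc ⟨z, hz⟩
  rw [mulVec, dotProduct_comm, hzero.dotProduct_eq hi, ← hcz]
  simp [hneg, mul_comm]

theorem IsResidual.regCoef_eq [DecidableEq V] {p : Measure (V → ℝ)} (hp : (covMat p).PosDef)
    {K P : Finset V} (i : K) (j : P) {a : V → ℝ} (ha : IsResidual (covMat p) P i a)
    (hi : (i : V) ∉ P) :
    regCoef p K P i j = -a j := by
  have hnormal : (fun z : P => -a z) ᵥ* covBlock p P P = covBlock p K P i := by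
    ext z
    have hz := ha.mulVec_eq_zero z z.2
    rw [mulVec, dotProduct_comm, ha.dotProduct_eq hi, ← covMat_transpose p] at hz
    simp only [vecMul, dotProduct, covBlock, submatrix_apply, neg_mul, Finset.sum_neg_distrib]
    exact neg_eq_of_add_eq_zero_left hz
  calc regCoef p K P i j = (covBlock p K P i ᵥ* (covBlock p P P)⁻¹) j := rfl
    _ = -a j := by
      rw [← hnormal, vecMul_vecMul, mul_nonsing_inv _ (isUnit_det_covBlock hp P), vecMul_one]

end Residual

section CondIndepCoords

open Matrix

variable {V : Type*} [Fintype V] {p : Measure (V → ℝ)} [IsGaussian p]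

theorem covariance_eval_dotProduct (a : V → ℝ) (i : V) :
    cov[fun x => x i, fun x => a ⬝ᵥ x; p] = (covMat p *ᵥ a) i := by
  classical
  simpa only [single_one_dotProduct] using covariance_dotProduct p (Pi.single i 1) a

theorem indepFun_restrict_dotProduct_iff {ι : Type*} [Finite ι] (a : ι → V → ℝ) (W : Finset V) :
    IndepFun (W.restrict (π := fun _ : V => ℝ)) (fun x i => a i ⬝ᵥ x) p ↔
      ∀ i, ∀ w ∈ W, (covMat p *ᵥ a i) w = 0 := by
  constructor
  · intro h i w hw
    have hiw : IndepFun (fun x : V → ℝ => x w) (fun x => a i ⬝ᵥ x) p :=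
      h.comp (φ := fun y : W → ℝ => y ⟨w, hw⟩) (ψ := fun y : ι → ℝ => y i)
        (measurable_pi_apply _) (measurable_pi_apply _)
    rw [← covariance_eval_dotProduct]
    exact hiw.covariance_eq_zero (memLp_eval_of_isGaussian p w)
      (memLp_finsetSum _ fun v _ => (memLp_eval_of_isGaussian p v).const_mul (a i v))
  · intro h
    have := Fintype.ofFinite ι
    let L : (V → ℝ) →ₗ[ℝ] (W → ℝ) × (ι → ℝ) :=
      (LinearMap.funLeft ℝ ℝ fun w : W => (w : V)).prod (Matrix.of a).mulVecLin
    have hlaw : HasGaussianLaw (fun x : V → ℝ => (fun w : W => x w, fun i => a i ⬝ᵥ x)) p :=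
      (IsGaussian.hasGaussianLaw_id (μ := p)).map_fun L.toContinuousLinearMap
    refine HasGaussianLaw.indepFun_of_covariance_eval (X := fun (w : W) (x : V → ℝ) => x w)
      (Y := fun i (x : V → ℝ) => a i ⬝ᵥ x) hlaw fun w i => ?_
    rw [covariance_eval_dotProduct]
    exact h i w w.2

theorem condIndepCoords_iff_indepFun {X Y Z : Finset V} (hXZ : Disjoint X Z)
    {a : X → V → ℝ} (ha : ∀ i : X, IsResidual (covMat p) Z i (a i)) :
    CondIndepCoords p X Y Z ↔
      IndepFun (fun x : V → ℝ => (Z.restrict (π := fun _ : V => ℝ) x,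
        Y.restrict (π := fun _ : V => ℝ) x)) (fun x i => a i ⬝ᵥ x) p := by
  set φ : (Z → ℝ) → X → ℝ := fun z i => -∑ w : Z, a i w * z w
  have hsub : (fun x : V → ℝ => X.restrict (π := fun _ : V => ℝ) x -
      φ (Z.restrict (π := fun _ : V => ℝ) x)) = fun x i => a i ⬝ᵥ x := by
    ext x i
    rw [(ha i).dotProduct_eq (Finset.disjoint_left.1 hXZ i.2)]
    simp [φ]
  have hindep : IndepFun (Z.restrict (π := fun _ : V => ℝ)) (fun x : V → ℝ =>
      X.restrict (π := fun _ : V => ℝ) x - φ (Z.restrict (π := fun _ : V => ℝ) x)) p := by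
    rw [hsub]
    exact (indepFun_restrict_dotProduct_iff a Z).2 fun i => (ha i).mulVec_eq_zero
  have key := condIndepFun_iff_indepFun_sub (Finset.measurable_restrict Z)
    (Finset.measurable_restrict X) (Finset.measurable_restrict (X := fun _ : V => ℝ) Y)
    (by fun_prop) hindep
  rw [hsub] at key
  exact ⟨fun h => key.1 (CondIndepFun.symm h), fun h => CondIndepFun.symm (key.2 h)⟩

theorem condIndepCoords_iff (hp : (covMat p).PosDef) {X Y Z : Finset V} (hXZ : Disjoint X Z) :
    CondIndepCoords p X Y Z ↔
      ∀ i ∈ X, ∀ j ∈ Y, ∃ a, IsResidual (covMat p) Z i a ∧ (covMat p *ᵥ a) j = 0 := by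
  classical
  choose a ha using fun i : X => exists_isResidual hp (Finset.disjoint_left.1 hXZ i.2)
  rw [condIndepCoords_iff_indepFun hXZ ha]
  constructor
  · intro h i hi j hj
    have hY : IndepFun (Y.restrict (π := fun _ : V => ℝ)) (fun x i => a i ⬝ᵥ x) p :=
      h.comp (φ := Prod.snd) (ψ := id) measurable_snd measurable_id
    exact ⟨a ⟨i, hi⟩, ha ⟨i, hi⟩, (indepFun_restrict_dotProduct_iff a Y).1 hY ⟨i, hi⟩ j hj⟩
  · intro h
    have hZY : IndepFun ((Z ∪ Y).restrict (π := fun _ : V => ℝ)) (fun x i => a i ⬝ᵥ x) p := by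
      refine (indepFun_restrict_dotProduct_iff a (Z ∪ Y)).2 fun i w hw => ?_
      rcases Finset.mem_union.1 hw with hw | hw
      · exact (ha i).mulVec_eq_zero w hw
      · obtain ⟨b, hb, hb0⟩ := h i i.2 w hw
        rwa [(ha i).eq hp hb]
    exact hZY.comp (φ := fun y : (Z ∪ Y : Finset V) → ℝ =>
      (fun z : Z => y ⟨z, Finset.mem_union_left _ z.2⟩,
        fun z : Y => y ⟨z, Finset.mem_union_right _ z.2⟩)) (ψ := id) (by fun_prop) measurable_id

theorem GlobalMarkov.exists_isResidual {G : UCG V} {i j : V}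
    (h : GlobalMarkov p G) (hp : (covMat p).PosDef) {X Y Z : Finset V} (hXY : Disjoint X Y)
    (hXZ : Disjoint X Z) (hYZ : Disjoint Y Z) (hsep : G.Separated X Y Z) (hi : i ∈ X) (hj : j ∈ Y) :
    ∃ a, IsResidual (covMat p) Z i a ∧ (covMat p *ᵥ a) j = 0 :=
  (condIndepCoords_iff hp hXZ).1 (h X Y Z hXY hXZ hYZ hsep) i hi j hj

end CondIndepCoords

namespace UCG

variable {V : Type*} {G : UCG V}

/-- There is an arrow, solid or dashed, from `a` to `b`. -/
def Arrow (G : UCG V) (a b : V) : Prop := G.solid a b ∨ G.dashed a b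

theorem Arrow.not_symm {a b : V} (h : G.Arrow a b) : ¬ G.Arrow b a := fun h' =>
  G.no_semidirected_cycle a b h (.single (or_assoc.1 (.inl h')))

theorem Arrow.not_und {a b : V} (h : G.Arrow a b) : ¬ G.und.Adj a b := fun h' =>
  G.no_semidirected_cycle a b h (.single (.inr (.inr h'.symm)))

/-- The marks that a route can leave at a node where it enters or leaves a maximal undirected
subroute: it ends there or the arrow points away (`tail`), or a dashed or a solid arrow points to
the node. -/
inductive Mark
  | tail
  | dashed
  | solid

theorem Mark.ne_tail_iff {m : Mark} : m ≠ .tail ↔ m = .dashed ∨ m = .solid := by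
  cases m <;> simp

/-- There is a directed edge between `a` and `c` that has the given mark at `c`. -/
def HasMark (G : UCG V) (a c : V) : Mark → Prop
  | .tail => G.Arrow c a
  | .dashed => G.dashed a c
  | .solid => G.solid a c

theorem HasMark.arrow {a c : V} {m : Mark} (h : G.HasMark a c m) : G.Arrow a c ∨ G.Arrow c a := by
  cases m
  · exact .inr h
  · exact .inl (.inr h)
  · exact .inl (.inl h)

theorem HasMark.not_und {a c : V} {m : Mark} (h : G.HasMark a c m) : ¬ G.und.Adj a c :=
  h.arrow.elim Arrow.not_und fun h' hu => h'.not_und hu.symm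

theorem HasMark.adjacent {a c : V} {m : Mark} (h : G.HasMark a c m) : G.Adjacent a c := by
  rcases h.arrow with (h | h) | h | h
  exacts [.inl h, .inr (.inr (.inl h)), .inr (.inl h), .inr (.inr (.inr (.inl h)))]

theorem HasMark.dashed_iff {a c : V} {m : Mark} (h : G.HasMark a c m) :
    G.dashed a c ↔ m = .dashed := by
  cases m with
  | tail => exact iff_of_false (fun h' => Arrow.not_symm h (.inr h')) nofun
  | dashed => exact iff_of_true h rfl
  | solid => exact iff_of_false (fun h' => G.not_solid_and_dashed a c ⟨h, h'⟩) nofun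

theorem HasMark.solid_iff {a c : V} {m : Mark} (h : G.HasMark a c m) :
    G.solid a c ↔ m = .solid := by
  cases m with
  | tail => exact iff_of_false (fun h' => Arrow.not_symm h (.inl h')) nofun
  | dashed => exact iff_of_false (fun h' => G.not_solid_and_dashed a c ⟨h', h⟩) nofun
  | solid => exact iff_of_true h rfl

section Sections

variable {N : ℕ} {r : ℕ → V} {s t i j k : ℕ} {e f : Mark}

/-- The mark at position `s` with which the route `r` enters this position. -/
def EntryAt (G : UCG V) (r : ℕ → V) (s : ℕ) (e : Mark) : Prop :=
  s = 0 ∧ e = .tail ∨ 1 ≤ s ∧ G.HasMark (r (s - 1)) (r s) e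

/-- The mark at position `t` with which the route `r 0, …, r N` leaves this position. -/
def ExitAt (G : UCG V) (N : ℕ) (r : ℕ → V) (t : ℕ) (f : Mark) : Prop :=
  t = N ∧ f = .tail ∨ t + 1 ≤ N ∧ G.HasMark (r (t + 1)) (r t) f

/-- The positions `s, …, t` form a maximal undirected subroute of the route `r 0, …, r N`, which
is entered with the mark `e` and left with the mark `f`. -/
structure IsSection (G : UCG V) (N : ℕ) (r : ℕ → V) (s t : ℕ) (e f : Mark) : Prop where
  le : s ≤ t
  und : ∀ i, s ≤ i → i < t → G.und.Adj (r i) (r (i + 1))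
  entry : G.EntryAt r s e
  exit : G.ExitAt N r t f

/-- Position `i` of a maximal undirected subroute with positions `s, …, t`, entry mark `e` and exit
mark `f` is a collider node; see `IsSection.isColliderNode_iff`. -/
def ColliderAt (s t : ℕ) (e f : Mark) (i : ℕ) : Prop :=
  i = s ∧ e = .dashed ∧ (s < t ∨ f ≠ .tail) ∨ i = t ∧ f = .dashed ∧ (s < t ∨ e ≠ .tail)

theorem EntryAt.not_und (h : G.EntryAt r s e) (hs : 1 ≤ s) : ¬ G.und.Adj (r (s - 1)) (r s) := by
  rcases h with ⟨rfl, -⟩ | ⟨-, h⟩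
  · omega
  · exact h.not_und

theorem ExitAt.not_und (h : G.ExitAt N r t f) (ht : t + 1 ≤ N) :
    ¬ G.und.Adj (r t) (r (t + 1)) := by
  rcases h with ⟨rfl, -⟩ | ⟨-, h⟩
  · omega
  · exact fun hu => h.not_und hu.symm

theorem EntryAt.dashed_iff (h : G.EntryAt r s e) :
    1 ≤ s ∧ G.dashed (r (s - 1)) (r s) ↔ e = .dashed := by
  rcases h with ⟨rfl, rfl⟩ | ⟨hs, h⟩
  · simp
  · rw [← h.dashed_iff, and_iff_right hs]

theorem EntryAt.solid_iff (h : G.EntryAt r s e) :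
    1 ≤ s ∧ G.solid (r (s - 1)) (r s) ↔ e = .solid := by
  rcases h with ⟨rfl, rfl⟩ | ⟨hs, h⟩
  · simp
  · rw [← h.solid_iff, and_iff_right hs]

theorem ExitAt.dashed_iff (h : G.ExitAt N r t f) :
    t + 1 ≤ N ∧ G.dashed (r (t + 1)) (r t) ↔ f = .dashed := by
  rcases h with ⟨rfl, rfl⟩ | ⟨ht, h⟩
  · simp
  · rw [← h.dashed_iff, and_iff_right ht]

theorem ExitAt.solid_iff (h : G.ExitAt N r t f) :
    t + 1 ≤ N ∧ G.solid (r (t + 1)) (r t) ↔ f = .solid := by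
  rcases h with ⟨rfl, rfl⟩ | ⟨ht, h⟩
  · simp
  · rw [← h.solid_iff, and_iff_right ht]

namespace IsSection

theorem le_length (h : G.IsSection N r s t e f) : t ≤ N := by
  rcases h.exit with ⟨rfl, -⟩ | ⟨ht, -⟩ <;> omega

theorem und_pred (h : G.IsSection N r s t e f) (hs : s < i) (ht : i ≤ t) :
    G.und.Adj (r (i - 1)) (r i) := by
  simpa only [Nat.sub_add_cancel (show 1 ≤ i by omega)] using h.und (i - 1) (by omega) (by omega)

theorem dashed_pred_iff (h : G.IsSection N r s t e f) (hs : s ≤ i) (ht : i ≤ t) :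
    1 ≤ i ∧ G.dashed (r (i - 1)) (r i) ↔ i = s ∧ e = .dashed := by
  rcases hs.eq_or_lt with rfl | hs
  · rw [h.entry.dashed_iff, eq_self, true_and]
  · refine iff_of_false (fun hd => ?_) (by omega)
    exact Arrow.not_und (.inr hd.2) (h.und_pred hs ht)

theorem dashed_succ_iff (h : G.IsSection N r s t e f) (hs : s ≤ i) (ht : i ≤ t) :
    i + 1 ≤ N ∧ G.dashed (r (i + 1)) (r i) ↔ i = t ∧ f = .dashed := by
  rcases ht.eq_or_lt with rfl | ht
  · rw [h.exit.dashed_iff, eq_self, true_and]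
  · refine iff_of_false (fun hd => ?_) (by omega)
    exact Arrow.not_und (.inr hd.2) (h.und i hs ht).symm

theorem into_pred_iff (h : G.IsSection N r s t e f) (hs : s ≤ i) (ht : i ≤ t) :
    1 ≤ i ∧ (G.dashed (r (i - 1)) (r i) ∨ G.und.Adj (r i) (r (i - 1)) ∨ G.solid (r (i - 1)) (r i))
      ↔ s < i ∨ e ≠ .tail := by
  rcases hs.eq_or_lt with rfl | hs
  · rw [Mark.ne_tail_iff, ← h.entry.dashed_iff, ← h.entry.solid_iff]
    have : 1 ≤ s → ¬ G.und.Adj (r s) (r (s - 1)) := fun hs hu => h.entry.not_und hs hu.symm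
    grind
  · exact iff_of_true ⟨by omega, .inr (.inl (h.und_pred hs ht).symm)⟩ (.inl hs)

theorem into_succ_iff (h : G.IsSection N r s t e f) (hs : s ≤ i) (ht : i ≤ t) :
    i + 1 ≤ N ∧ (G.dashed (r (i + 1)) (r i) ∨ G.und.Adj (r i) (r (i + 1)) ∨
      G.solid (r (i + 1)) (r i)) ↔ i < t ∨ f ≠ .tail := by
  rcases ht.eq_or_lt with rfl | ht
  · rw [Mark.ne_tail_iff, ← h.exit.dashed_iff, ← h.exit.solid_iff]
    have := h.exit.not_und
    grind
  · exact iff_of_true ⟨ht.trans_le h.le_length, .inr (.inl (h.und i hs ht))⟩ (.inl ht)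

theorem isColliderNode_iff (h : G.IsSection N r s t e f) (hs : s ≤ i) (ht : i ≤ t) :
    G.IsColliderNode N r i ↔ ColliderAt s t e f i := by
  have hpred := h.dashed_pred_iff hs ht
  have hsucc := h.dashed_succ_iff hs ht
  have hinto_pred := h.into_pred_iff hs ht
  have hinto_succ := h.into_succ_iff hs ht
  unfold IsColliderNode ColliderTriple ColliderAt
  grind

theorem eq_of_isColliderSection (h : G.IsSection N r s t e f) (hjk : G.IsColliderSection N r j k)
    (hj : j ≤ t) (hk : s ≤ k) : j = s ∧ k = t := by
  obtain ⟨hj1, -, hkN, hund, hleft, hright⟩ := hjk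
  have hsj : s ≤ j := by
    by_contra! hlt
    refine h.entry.not_und (by omega) ?_
    simpa only [Nat.sub_add_cancel (show 1 ≤ s by omega)] using hund (s - 1) (by omega) (by omega)
  have hkt : k ≤ t := by
    by_contra! hlt
    exact h.exit.not_und (by omega) (hund t (by omega) hlt)
  refine ⟨hsj.antisymm' (not_lt.1 fun hlt => ?_), hkt.antisymm (not_lt.1 fun hlt => ?_)⟩
  · exact Arrow.not_und (.inl hleft) (h.und_pred hlt hj)
  · exact Arrow.not_und (.inl hright) (h.und k hk hlt).symm

theorem isColliderSection_iff (h : G.IsSection N r s t e f) :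
    G.IsColliderSection N r s t ↔ e = .solid ∧ f = .solid := by
  rw [← h.entry.solid_iff, ← h.exit.solid_iff]
  exact ⟨fun ⟨hs, _, ht, _, hleft, hright⟩ => ⟨⟨hs, hleft⟩, ht, hright⟩,
    fun ⟨⟨hs, hleft⟩, ht, hright⟩ => ⟨hs, h.le, ht, h.und, hleft, hright⟩⟩

end IsSection

/-- The maximal undirected subroute of `r` with positions `s, …, t`, entry mark `e` and exit
mark `f` satisfies the requirements for a `Z`-open route. -/
structure SectionOpen (Z : Finset V) (r : ℕ → V) (s t : ℕ) (e f : Mark) : Prop where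
  exists_mem : e = .solid → f = .solid → ∃ i, s ≤ i ∧ i ≤ t ∧ r i ∈ Z
  mem_iff : ¬ (e = .solid ∧ f = .solid) → ∀ i, s ≤ i → i ≤ t → (r i ∈ Z ↔ ColliderAt s t e f i)

/-- The positions of the route before `t` satisfy the requirements for being `Z`-open. -/
structure OpenBefore (G : UCG V) (Z : Finset V) (N : ℕ) (r : ℕ → V) (t : ℕ) : Prop where
  node : ∀ i < t, G.IsColliderNode N r i → r i ∈ Z
  sect : ∀ j k, k < t → G.IsColliderSection N r j k → ∃ i, j ≤ i ∧ i ≤ k ∧ r i ∈ Z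
  other : ∀ i < t, ¬ G.IsColliderNode N r i →
    (¬ ∃ j k, G.IsColliderSection N r j k ∧ j ≤ i ∧ i ≤ k) → r i ∉ Z

variable {Z : Finset V}

theorem isOpen_of_openBefore (h : G.OpenBefore Z N r (N + 1)) : G.IsOpen Z N r :=
  ⟨fun i hi => h.node i (by have := hi.2.1; omega) hi,
    fun j k hjk => h.sect j k (by have := hjk.2.2.1; omega) hjk,
    fun i hi => h.other i (Nat.lt_succ_of_le hi)⟩

theorem IsSection.openBefore_succ (h : G.IsSection N r s t e f) (hZ : SectionOpen Z r s t e f)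
    (hs : G.OpenBefore Z N r s) : G.OpenBefore Z N r (t + 1) where
  node i hi hc := by
    rcases lt_or_ge i s with his | his
    · exact hs.node i his hc
    · rw [h.isColliderNode_iff his (by omega)] at hc
      exact (hZ.mem_iff (by rintro ⟨rfl, rfl⟩; simp [ColliderAt] at hc) i his (by omega)).2 hc
  sect j k hk hjk := by
    rcases lt_or_ge k s with hks | hks
    · exact hs.sect j k hks hjk
    · obtain ⟨rfl, rfl⟩ := h.eq_of_isColliderSection hjk (by have := hjk.2.1; omega) hks
      exact hZ.exists_mem (h.isColliderSection_iff.1 hjk).1 (h.isColliderSection_iff.1 hjk).2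
  other i hi hc hsect := by
    rcases lt_or_ge i s with his | his
    · exact hs.other i his hc hsect
    · have hnot : ¬ (e = .solid ∧ f = .solid) := fun hef =>
        hsect ⟨s, t, h.isColliderSection_iff.2 hef, his, by omega⟩
      rwa [hZ.mem_iff hnot i his (by omega), ← h.isColliderNode_iff his (by omega)]

theorem IsOpen.sectionOpen (ho : G.IsOpen Z N r) (h : G.IsSection N r s t e f) :
    SectionOpen Z r s t e f where
  exists_mem he hf := ho.2.1 s t (h.isColliderSection_iff.2 ⟨he, hf⟩)
  mem_iff hnot i hs ht := by
    rw [← h.isColliderNode_iff hs ht]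
    refine ⟨fun hi => by_contra fun hc => ?_, ho.1 i⟩
    refine ho.2.2 i (ht.trans h.le_length) hc (fun ⟨j, k, hjk, hj, hk⟩ => hnot ?_) hi
    obtain ⟨rfl, rfl⟩ := h.eq_of_isColliderSection hjk (hj.trans ht) (hs.trans hk)
    exact h.isColliderSection_iff.1 hjk

end Sections

end UCG

namespace UCG

variable {V : Type*} {G : UCG V}

section Extension

variable {X Z : Finset V} {n s t i j k : ℕ} {r r' : ℕ → V} {e f : Mark}

theorem IsRoute.extend (h : G.IsRoute n r) (hr : ∀ i ≤ n, r' i = r i)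
    (ha : G.Adjacent (r n) (r' (n + 1))) : G.IsRoute (n + 1) r' := by
  intro i hi
  rcases Nat.lt_succ_iff_lt_or_eq.1 hi with hi | rfl
  · rw [hr i hi.le, hr (i + 1) hi]
    exact h i hi
  · rwa [hr i le_rfl]

theorem EntryAt.congr (h : G.EntryAt r s e) (hr : ∀ i ≤ s, r' i = r i) : G.EntryAt r' s e := by
  rwa [EntryAt, hr s le_rfl, hr (s - 1) (Nat.sub_le s 1)]

theorem SectionOpen.congr (h : SectionOpen Z r s t e f) (hr : ∀ i ≤ t, r' i = r i) :
    SectionOpen Z r' s t e f where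
  exists_mem he hf := by
    obtain ⟨i, hs, ht, hi⟩ := h.exists_mem he hf
    exact ⟨i, hs, ht, by rwa [hr i ht]⟩
  mem_iff hef i hs ht := by
    rw [hr i ht]
    exact h.mem_iff hef i hs ht

theorem isColliderNode_congr (hr : ∀ i ≤ n, r' i = r i) (hi : i < n) :
    G.IsColliderNode (n + 1) r' i ↔ G.IsColliderNode n r i := by
  have hlen : i + 1 ≤ n + 1 ↔ i + 1 ≤ n := by omega
  rw [IsColliderNode, IsColliderNode, hlen, hr i hi.le, hr (i + 1) hi, hr (i - 1) (by omega)]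

theorem isColliderSection_congr (hr : ∀ i ≤ n, r' i = r i) (hk : k < n) :
    G.IsColliderSection (n + 1) r' j k ↔ G.IsColliderSection n r j k := by
  unfold IsColliderSection
  grind

theorem OpenBefore.extend (h : G.OpenBefore Z n r t) (hr : ∀ i ≤ n, r' i = r i) (ht : t ≤ n) :
    G.OpenBefore Z (n + 1) r' t where
  node i hi hc := by
    rw [hr i (by omega)]
    exact h.node i hi ((isColliderNode_congr hr (by omega)).1 hc)
  sect j k hk hs := by
    obtain ⟨i, hj, hik, hi⟩ := h.sect j k hk ((isColliderSection_congr hr (by omega)).1 hs)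
    exact ⟨i, hj, hik, by rwa [hr i (by omega)]⟩
  other i hi hc hs := by
    rw [hr i (by omega)]
    refine h.other i hi (fun hc' => hc ((isColliderNode_congr hr (by omega)).2 hc')) ?_
    rintro ⟨j, k, hjk, hj, hk⟩
    exact hs ⟨j, k, (isColliderSection_congr hr hjk.2.2.1).2 hjk, hj, hk⟩

/-- The route `r 0, …, r n` starts in `X`, ends with an undirected subroute with positions
`s, …, n`, which is entered with the mark `e`, and is `Z`-open before `s`. -/
structure EndsWithSection (G : UCG V) (X Z : Finset V) (n : ℕ) (r : ℕ → V) (s : ℕ) (e : Mark) :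
    Prop where
  route : G.IsRoute n r
  start : r 0 ∈ X
  le : s ≤ n
  und : ∀ i, s ≤ i → i < n → G.und.Adj (r i) (r (i + 1))
  before : G.OpenBefore Z n r s
  entry : G.EntryAt r s e

namespace EndsWithSection

theorem isOpen (h : G.EndsWithSection X Z n r s e) (hZ : SectionOpen Z r s n e .tail) :
    G.IsOpen Z n r :=
  isOpen_of_openBefore
    (IsSection.openBefore_succ ⟨h.le, h.und, h.entry, .inl ⟨rfl, rfl⟩⟩ hZ h.before)

theorem extend_und (h : G.EndsWithSection X Z n r s e) (hr : ∀ i ≤ n, r' i = r i)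
    (hv : G.und.Adj (r n) (r' (n + 1))) : G.EndsWithSection X Z (n + 1) r' s e where
  route := h.route.extend hr (.inr (.inr (.inr (.inr hv))))
  start := by rw [hr 0 (by omega)]; exact h.start
  le := h.le.trans n.le_succ
  und i hi hi' := by
    rcases Nat.lt_succ_iff_lt_or_eq.1 hi' with hi' | rfl
    · rw [hr i hi'.le, hr (i + 1) hi']
      exact h.und i hi hi'
    · rwa [hr i le_rfl]
  before := h.before.extend hr h.le
  entry := h.entry.congr fun i hi => hr i (hi.trans h.le)

theorem extend_arrow (h : G.EndsWithSection X Z n r s e) (hZ : SectionOpen Z r s n e f)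
    (hr : ∀ i ≤ n, r' i = r i) (hf : G.HasMark (r' (n + 1)) (r n) f) {e' : Mark}
    (he' : G.HasMark (r n) (r' (n + 1)) e') :
    G.EndsWithSection X Z (n + 1) r' (n + 1) e' where
  route := h.route.extend hr he'.adjacent
  start := by rw [hr 0 (by omega)]; exact h.start
  le := le_rfl
  und i hi hi' := by omega
  before := by
    refine IsSection.openBefore_succ (s := s) (e := e) (f := f) ⟨h.le, fun i hi hi' => ?_,
      h.entry.congr fun i hi => hr i (hi.trans h.le), ?_⟩ (hZ.congr hr) (h.before.extend hr h.le)
    · rw [hr i hi'.le, hr (i + 1) hi']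
      exact h.und i hi hi'
    · exact .inr ⟨le_rfl, by rwa [hr n le_rfl]⟩
  entry := .inr ⟨by omega, by rwa [Nat.add_sub_cancel, hr n le_rfl]⟩

end EndsWithSection

end Extension

/-- The unknowns, at every node, of the linear system that determines the residual of a node
given `Z`; see `flowMap`. -/
inductive FlowKind
  | value
  | noise
  | score
  | dual
  | mean
  deriving DecidableEq

open FlowKind

instance : Fintype FlowKind := ⟨{value, noise, score, dual, mean}, fun q => by cases q <;> simp⟩

/-- `FlowStep G Z (q, u) (q', v)` says that the unknown of kind `q` at `u` may occur in the
equation for the unknown of kind `q'` at `v`. -/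
inductive FlowStep (G : UCG V) (Z : Finset V) : FlowKind × V → FlowKind × V → Prop
  | noise_value {v} : v ∉ Z → FlowStep G Z (noise, v) (value, v)
  | value_value {u v} : G.dashed u v → v ∉ Z → FlowStep G Z (value, u) (value, v)
  | score_noise {v} : v ∉ Z → FlowStep G Z (score, v) (noise, v)
  | value_noise_of_solid {u v} : G.solid u v → v ∉ Z → FlowStep G Z (value, u) (noise, v)
  | noise_noise {u v} : G.und.Adj u v → v ∉ Z → FlowStep G Z (noise, u) (noise, v)
  | value_noise_of_dashed {u v} : G.dashed u v → v ∈ Z → FlowStep G Z (value, u) (noise, v)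
  | noise_score {v} : v ∈ Z → FlowStep G Z (noise, v) (score, v)
  | noise_score_of_und {u v} : G.und.Adj u v → v ∈ Z → FlowStep G Z (noise, u) (score, v)
  | value_score {u v} : G.solid u v → v ∈ Z → FlowStep G Z (value, u) (score, v)
  | score_score {u v} : G.dashed v u → v ∉ Z → FlowStep G Z (score, u) (score, v)
  | dual_score {u v} : G.solid v u → v ∉ Z → FlowStep G Z (dual, u) (score, v)
  | score_dual {v} : v ∉ Z → FlowStep G Z (score, v) (dual, v)
  | dual_dual {u v} : G.und.Adj u v → v ∉ Z → FlowStep G Z (dual, u) (dual, v)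
  | noise_dual {v} : v ∈ Z → FlowStep G Z (noise, v) (dual, v)
  | mean_dual {v} : v ∈ Z → FlowStep G Z (mean, v) (dual, v)
  | mean_mean {u v} : G.und.Adj u v → FlowStep G Z (mean, u) (mean, v)
  | value_mean {u v} : G.solid u v → FlowStep G Z (value, u) (mean, v)

/-- The condition on the last undirected subroute `r s, …, r n` of a route, which is entered with
the mark `e`, under which the route accounts for the unknown of the given kind at `r n`. -/
def FlowSection (Z : Finset V) (r : ℕ → V) (s n : ℕ) (e : Mark) : FlowKind → Prop
  | value => SectionOpen Z r s n e .tail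
  | score => SectionOpen Z r s n e .dashed
  | dual => SectionOpen Z r s n e .solid
  | noise => ∀ i, s ≤ i → i ≤ n → (r i ∈ Z ↔ i = s ∧ e = .dashed)
  | mean => e = .solid

/-- There is a route from `X` to the given node that accounts for the unknown of the given kind
at this node. -/
def FlowReachable (G : UCG V) (X Z : Finset V) (a : FlowKind × V) : Prop :=
  ∃ n r s e, r n = a.2 ∧ G.EndsWithSection X Z n r s e ∧ FlowSection Z r s n e a.1

/-- The kind of unknown that a route accounts for if it can be continued by an edge with the given
mark at its last node. -/
def exitKind : Mark → FlowKind
  | .tail => value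
  | .dashed => score
  | .solid => dual

section Flow

variable {X Z : Finset V} {u v : V} {q q' : FlowKind} {n s : ℕ} {r : ℕ → V} {e f : Mark}

theorem flowSection_value_self (hn : r n ∉ Z) : FlowSection Z r n n e value where
  exists_mem _ := nofun
  mem_iff _ i hi hi' := by
    unfold ColliderAt
    grind

theorem flowSection_noise_self (hn : r n ∈ Z ↔ e = .dashed) : FlowSection Z r n n e noise := by
  intro i hi hi'
  grind

theorem flowSection_score_self (hn : r n ∈ Z ↔ e ≠ .tail) : FlowSection Z r n n e score where
  exists_mem _ := nofun
  mem_iff _ i hi hi' := by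
    unfold ColliderAt
    grind

theorem flowSection_dual_self (hn : r n ∈ Z ↔ e ≠ .tail) : FlowSection Z r n n e dual where
  exists_mem he _ := ⟨n, le_rfl, le_rfl, hn.2 (by simp [he])⟩
  mem_iff hef i hi hi' := by
    unfold ColliderAt
    cases e <;> grind

theorem FlowReachable.of_same (h : G.FlowReachable X Z (q, v))
    (hq : ∀ n r s e, r n = v → s ≤ n → FlowSection Z r s n e q → FlowSection Z r s n e q') :
    G.FlowReachable X Z (q', v) := by
  obtain ⟨n, r, s, e, hrn, h, hs⟩ := h
  exact ⟨n, r, s, e, hrn, h, hq n r s e hrn h.le hs⟩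

theorem FlowReachable.of_und (h : G.FlowReachable X Z (q, u)) (hu : G.und.Adj u v)
    (hq : ∀ n r s e, r (n + 1) = v → s ≤ n → FlowSection Z r s n e q →
      FlowSection Z r s (n + 1) e q') :
    G.FlowReachable X Z (q', v) := by
  obtain ⟨n, r, s, e, rfl, h, hs⟩ := h
  have hr : ∀ i ≤ n, Function.update r (n + 1) v i = r i := fun i hi =>
    Function.update_of_ne (by omega) v r
  have hv : Function.update r (n + 1) v (n + 1) = v := Function.update_self (n + 1) v r
  refine ⟨n + 1, _, s, e, hv, h.extend_und hr (by rwa [hv]), hq n _ s e hv h.le ?_⟩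
  cases q with
  | noise => exact fun i hi hi' => by rw [hr i hi', hs i hi hi']
  | mean => exact hs
  | value | score | dual => exact hs.congr hr

theorem FlowReachable.of_arrow
    (h : G.FlowReachable X Z (exitKind f, u)) (hf : G.HasMark v u f) (he : G.HasMark u v e)
    (hq : ∀ n r, r n = v → FlowSection Z r n n e q') : G.FlowReachable X Z (q', v) := by
  obtain ⟨n, r, s, e', rfl, h, hs⟩ := h
  have hr : ∀ i ≤ n, Function.update r (n + 1) v i = r i := fun i hi =>
    Function.update_of_ne (by omega) v r
  have hv : Function.update r (n + 1) v (n + 1) = v := Function.update_self (n + 1) v r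
  refine ⟨n + 1, _, n + 1, e, hv, h.extend_arrow (f := f) ?_ hr (by rwa [hv]) (by rwa [hv]),
    hq (n + 1) _ hv⟩
  cases f <;> exact hs

theorem FlowReachable.of_dashed (h : G.FlowReachable X Z (value, u)) (hd : G.dashed u v)
    (hq : ∀ n r, r n = v → FlowSection Z r n n .dashed q') : G.FlowReachable X Z (q', v) :=
  h.of_arrow (f := .tail) (e := .dashed) (.inr hd) hd hq

theorem FlowReachable.of_solid (h : G.FlowReachable X Z (value, u)) (hs : G.solid u v)
    (hq : ∀ n r, r n = v → FlowSection Z r n n .solid q') : G.FlowReachable X Z (q', v) :=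
  h.of_arrow (f := .tail) (e := .solid) (.inl hs) hs hq

theorem flowReachable_score_self (hv : v ∈ X) (hvZ : v ∉ Z) :
    G.FlowReachable X Z (score, v) := by
  refine ⟨0, fun _ => v, 0, .tail, rfl, ⟨nofun, hv, le_rfl, nofun, ⟨nofun, nofun, nofun⟩,
    .inl ⟨rfl, rfl⟩⟩, flowSection_score_self ?_⟩
  simp [hvZ]

theorem FlowSection.value_of_noise (h : FlowSection Z r s n e noise) (hn : r n ∉ Z) (hs : s ≤ n) :
    FlowSection Z r s n e value where
  exists_mem _ := nofun
  mem_iff _ i hi hi' := by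
    rw [h i hi hi', ColliderAt]
    have := h n hs le_rfl
    grind

theorem FlowSection.eq_of_score (h : FlowSection Z r s n e score) (hn : r n ∉ Z) (hs : s ≤ n) :
    s = n ∧ e = .tail := by
  have := h.mem_iff (by simp) n hs le_rfl
  unfold ColliderAt at this
  grind

theorem FlowSection.eq_of_noise (h : FlowSection Z r s n e noise) (hn : r n ∈ Z) (hs : s ≤ n) :
    s = n ∧ e = .dashed := by
  have := h n hs le_rfl
  grind

theorem FlowSection.dual_of_mean (h : FlowSection Z r s n e mean) (hn : r n ∈ Z) (hs : s ≤ n) :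
    FlowSection Z r s n e dual where
  exists_mem _ _ := ⟨n, hs, le_rfl, hn⟩
  mem_iff hef := absurd ⟨h, rfl⟩ hef

theorem FlowSection.noise_succ (h : FlowSection Z r s n e noise) (hn : r (n + 1) ∉ Z)
    (hs : s ≤ n) : FlowSection Z r s (n + 1) e noise := by
  intro i hi hi'
  have := h i hi
  grind

theorem FlowSection.score_succ (h : FlowSection Z r s n e noise) (hn : r (n + 1) ∈ Z)
    (hs : s ≤ n) : FlowSection Z r s (n + 1) e score where
  exists_mem _ := nofun
  mem_iff _ i hi hi' := by
    have := h i hi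
    unfold ColliderAt
    grind

theorem FlowSection.dual_succ (h : FlowSection Z r s n e dual) (hn : r (n + 1) ∉ Z)
    (hs : s ≤ n) : FlowSection Z r s (n + 1) e dual where
  exists_mem he hf := by
    obtain ⟨i, hi, hi', hmem⟩ := h.exists_mem he hf
    exact ⟨i, hi, by omega, hmem⟩
  mem_iff hef i hi hi' := by
    have := h.mem_iff hef i hi
    unfold ColliderAt at this ⊢
    grind

theorem FlowReachable.step {a b : FlowKind × V} (h : G.FlowReachable X Z a)
    (hab : G.FlowStep Z a b) : G.FlowReachable X Z b := by
  cases hab with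
  | noise_value hv => exact h.of_same fun n r s e hr hs hq => hq.value_of_noise (hr ▸ hv) hs
  | score_noise hv =>
    refine h.of_same fun n r s e hr hs hq => ?_
    obtain ⟨rfl, rfl⟩ := hq.eq_of_score (hr ▸ hv) hs
    exact flowSection_noise_self (by simp [hr, hv])
  | score_dual hv =>
    refine h.of_same fun n r s e hr hs hq => ?_
    obtain ⟨rfl, rfl⟩ := hq.eq_of_score (hr ▸ hv) hs
    exact flowSection_dual_self (by simp [hr, hv])
  | noise_score hv =>
    refine h.of_same fun n r s e hr hs hq => ?_
    obtain ⟨rfl, rfl⟩ := hq.eq_of_noise (hr ▸ hv) hs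
    exact flowSection_score_self (by simp [hr, hv])
  | noise_dual hv =>
    refine h.of_same fun n r s e hr hs hq => ?_
    obtain ⟨rfl, rfl⟩ := hq.eq_of_noise (hr ▸ hv) hs
    exact flowSection_dual_self (by simp [hr, hv])
  | mean_dual hv => exact h.of_same fun n r s e hr hs hq => hq.dual_of_mean (hr ▸ hv) hs
  | noise_noise hu hv => exact h.of_und hu fun n r s e hr hs hq => hq.noise_succ (hr ▸ hv) hs
  | noise_score_of_und hu hv =>
    exact h.of_und hu fun n r s e hr hs hq => hq.score_succ (hr ▸ hv) hs
  | dual_dual hu hv => exact h.of_und hu fun n r s e hr hs hq => hq.dual_succ (hr ▸ hv) hs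
  | mean_mean hu => exact h.of_und hu fun _ _ _ _ _ _ hq => hq
  | value_value hd hv => exact h.of_dashed hd fun n r hr => flowSection_value_self (hr ▸ hv)
  | value_noise_of_solid hs hv =>
    exact h.of_solid hs fun n r hr => flowSection_noise_self (by simp [hr, hv])
  | value_noise_of_dashed hd hv =>
    exact h.of_dashed hd fun n r hr => flowSection_noise_self (by simp [hr, hv])
  | value_score hs hv =>
    exact h.of_solid hs fun n r hr => flowSection_score_self (by simp [hr, hv])
  | value_mean hs => exact h.of_solid hs fun _ _ _ => rfl
  | score_score hd hv =>
    exact h.of_arrow (f := .dashed) (e := .tail) hd (.inr hd) fun n r hr =>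
      flowSection_score_self (by simp [hr, hv])
  | dual_score hs hv =>
    exact h.of_arrow (f := .solid) (e := .tail) hs (.inl hs) fun n r hr =>
      flowSection_score_self (by simp [hr, hv])

end Flow

theorem not_separated_of_reflTransGen_flowStep {X Y Z : Finset V} {x y : V} (hx : x ∈ X)
    (hy : y ∈ Y) (hxZ : x ∉ Z)
    (h : Relation.ReflTransGen (G.FlowStep Z) (score, x) (value, y)) : ¬ G.Separated X Y Z := by
  have hreach : G.FlowReachable X Z (value, y) :=
    Relation.ReflTransGen.rec (motive := fun b _ => G.FlowReachable X Z b)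
      (flowReachable_score_self hx hxZ) (fun _ hab ih => ih.step hab) h
  obtain ⟨n, r, s, e, hr, hends, hs⟩ := hreach
  exact fun hsep => hsep ⟨n, r, hends.route, hends.start, hr ▸ hy, hends.isOpen hs⟩

end UCG

section

open Matrix

theorem mulVec_apply_eq_zero {V : Type*} [Fintype V] {A : Matrix V V ℝ} {x : V → ℝ} {v : V}
    (h : ∀ w, A v w ≠ 0 → x w = 0) : (A *ᵥ x) v = 0 :=
  Finset.sum_eq_zero fun w _ => mul_eq_zero.2 (or_iff_not_imp_left.2 (h w))

theorem exists_mem_apply_eq_of_injective {K E : Type*} [DivisionRing K] [AddCommGroup E]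
    [Module K E] [FiniteDimensional K E] {L : E →ₗ[K] E} (hL : Function.Injective L)
    {W : Submodule K E} (hW : ∀ u ∈ W, L u ∈ W) {y : E} (hy : y ∈ W) : ∃ u ∈ W, L u = y := by
  have hinj : Function.Injective (L.restrict hW) := fun u u' h =>
    Subtype.ext (hL (congrArg Subtype.val h))
  obtain ⟨u, hu⟩ := LinearMap.injective_iff_surjective.1 hinj ⟨y, hy⟩
  exact ⟨u, u.2, congrArg Subtype.val hu⟩

end

namespace UCG

open FlowKind Matrix

variable {V : Type*} [Fintype V] [DecidableEq V]

/-- A linear model with covariance matrix `Sg` for the UCG `G`: the matrices `M`, `β` and `S` have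
zeros where `G` lacks undirected, dashed and solid edges, respectively, and `Sg` is the covariance
matrix of a solution `x` of `(M (1 - β) - S) x = ε`, where `ε` has the covariance matrix `M`. -/
structure IsParametrization (G : UCG V) (Sg M β S : Matrix V V ℝ) : Prop where
  und : ∀ i j, M i j ≠ 0 → i = j ∨ G.und.Adj i j
  dashed : ∀ i j, β i j ≠ 0 → G.dashed j i
  solid : ∀ i j, S i j ≠ 0 → G.solid j i
  posDef : M.PosDef
  cov_eq : (M * (1 - β) - S) * Sg * (M * (1 - β) - S)ᵀ = M

/-- The residual `a = m - βᵀ m - Sᵀ l` that is determined by the unknowns `m` (`score`) and `l`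
(`dual`) of the linear system of `flowMap`. -/
def flowResidual (β S : Matrix V V ℝ) (u : FlowKind → V → ℝ) : V → ℝ :=
  u score - βᵀ *ᵥ u score - Sᵀ *ᵥ u dual

/-- The linear system that determines the residual `a` of a node given `Z`. Its unknowns are the
covariances `b = Σ a` with the coordinates (`value`), `y = (1 - β) b` (`noise`), `m = M y - S b`
(`score`), `l = M⁻¹ m` (`dual`) and `w = M⁻¹ S b` (`mean`), which satisfy `a = m - βᵀ m - Sᵀ l` and
`l = y - w`. At each node one equation per unknown is selected, depending on membership in `Z`, in
such a way that the dependencies are those of `FlowStep`. -/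
noncomputable def flowMap (M β S : Matrix V V ℝ) (Z : Finset V) :
    (FlowKind → V → ℝ) →ₗ[ℝ] FlowKind → V → ℝ where
  toFun u
    | value, v => if v ∈ Z then u value v else u value v - u noise v - (β *ᵥ u value) v
    | noise, v => if v ∈ Z then u noise v + (β *ᵥ u value) v else
        (M *ᵥ u noise) v - (S *ᵥ u value) v - u score v
    | score, v => if v ∈ Z then u score v - (M *ᵥ u noise) v + (S *ᵥ u value) v else
        flowResidual β S u v
    | dual, v => if v ∈ Z then u dual v - u noise v + u mean v else (M *ᵥ u dual) v - u score v
    | mean, v => (M *ᵥ u mean) v - (S *ᵥ u value) v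
  map_add' u u' := by
    ext q v
    cases q <;> simp only [Pi.add_apply, mulVec_add, flowResidual, Pi.sub_apply] <;>
      (try split_ifs) <;> ring
  map_smul' c u := by
    ext q v
    cases q <;> simp only [Pi.smul_apply, mulVec_smul, flowResidual, Pi.sub_apply, smul_eq_mul,
      RingHom.id_apply] <;> (try split_ifs) <;> ring

variable {G : UCG V} {M β S Sg : Matrix V V ℝ} {Z : Finset V} {u : FlowKind → V → ℝ}

theorem IsParametrization.flowMap_apply_eq_zero (h : G.IsParametrization Sg M β S)
    {R : Set (FlowKind × V)} (hR : ∀ s t, s ∈ R → G.FlowStep Z s t → t ∈ R)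
    (hu : ∀ q v, (q, v) ∉ R → u q v = 0) (q : FlowKind) (v : V) (hqv : (q, v) ∉ R) :
    flowMap M β S Z u q v = 0 := by
  have hz : ∀ q' w, G.FlowStep Z (q', w) (q, v) → u q' w = 0 := fun q' w hstep =>
    hu q' w fun hmem => hqv (hR _ _ hmem hstep)
  have hM : ∀ q', u q' v = 0 → (∀ w, G.und.Adj w v → u q' w = 0) → (M *ᵥ u q') v = 0 := by
    refine fun q' hv hund => mulVec_apply_eq_zero fun w hw => ?_
    rcases h.und v w hw with rfl | hadj
    exacts [hv, hund w hadj.symm]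
  have hβ : ∀ q', (∀ w, G.dashed w v → u q' w = 0) → (β *ᵥ u q') v = 0 :=
    fun q' hq => mulVec_apply_eq_zero fun w hw => hq w (h.dashed v w hw)
  have hS : ∀ q', (∀ w, G.solid w v → u q' w = 0) → (S *ᵥ u q') v = 0 :=
    fun q' hq => mulVec_apply_eq_zero fun w hw => hq w (h.solid v w hw)
  have hβT : ∀ q', (∀ w, G.dashed v w → u q' w = 0) → (βᵀ *ᵥ u q') v = 0 :=
    fun q' hq => mulVec_apply_eq_zero fun w hw => hq w (h.dashed w v hw)
  have hST : ∀ q', (∀ w, G.solid v w → u q' w = 0) → (Sᵀ *ᵥ u q') v = 0 :=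
    fun q' hq => mulVec_apply_eq_zero fun w hw => hq w (h.solid w v hw)
  have hself : u q v = 0 := hu q v hqv
  cases q <;> simp only [flowMap, flowResidual, Pi.sub_apply, LinearMap.coe_mk, AddHom.coe_mk] <;>
    (try split_ifs with hv)
  · exact hself
  · rw [hself, hz _ _ (.noise_value hv), hβ _ fun w hw => hz _ _ (.value_value hw hv)]
    ring
  · rw [hself, hβ _ fun w hw => hz _ _ (.value_noise_of_dashed hw hv), add_zero]
  · rw [hM _ hself fun w hw => hz _ _ (.noise_noise hw hv), hz _ _ (.score_noise hv),
      hS _ fun w hw => hz _ _ (.value_noise_of_solid hw hv)]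
    ring
  · rw [hself, hM _ (hz _ _ (.noise_score hv)) fun w hw => hz _ _ (.noise_score_of_und hw hv),
      hS _ fun w hw => hz _ _ (.value_score hw hv)]
    ring
  · rw [hself, hβT _ fun w hw => hz _ _ (.score_score hw hv),
      hST _ fun w hw => hz _ _ (.dual_score hw hv)]
    ring
  · rw [hself, hz _ _ (.noise_dual hv), hz _ _ (.mean_dual hv)]
    ring
  · rw [hM _ hself fun w hw => hz _ _ (.dual_dual hw hv), hz _ _ (.score_dual hv), sub_zero]
  · rw [hM _ hself fun w hw => hz _ _ (.mean_mean hw), hS _ fun w hw => hz _ _ (.value_mean hw),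
      sub_zero]

/-- The unknowns `u` solve the equations of the flow system with the possible exception of those
for `score` outside `Z`, where the system for the residual of a node has its source term. -/
def IsFlowSolution (M β S : Matrix V V ℝ) (Z : Finset V) (u : FlowKind → V → ℝ) : Prop :=
  ∀ q v, (q = score → v ∈ Z) → flowMap M β S Z u q v = 0

namespace IsFlowSolution

theorem value_eq_zero (hu : IsFlowSolution M β S Z u) {v : V} (hv : v ∈ Z) : u value v = 0 := by
  simpa [flowMap, hv] using hu value v nofun

theorem noise_eq (hu : IsFlowSolution M β S Z u) : u noise = (1 - β) *ᵥ u value := by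
  ext v
  have hvalue := hu value v nofun
  have hnoise := hu noise v nofun
  simp only [flowMap, LinearMap.coe_mk, AddHom.coe_mk] at hvalue hnoise
  rw [sub_mulVec, one_mulVec, Pi.sub_apply]
  split_ifs at hvalue hnoise <;> linarith

theorem score_eq (hu : IsFlowSolution M β S Z u) :
    u score = (M * (1 - β) - S) *ᵥ u value := by
  rw [sub_mulVec, ← mulVec_mulVec, ← hu.noise_eq]
  ext v
  have hnoise := hu noise v nofun
  have hscore := hu score v
  simp only [flowMap, LinearMap.coe_mk, AddHom.coe_mk] at hnoise hscore
  rw [Pi.sub_apply]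
  by_cases hv : v ∈ Z
  · have := hscore fun _ => hv
    rw [if_pos hv] at this
    linarith
  · rw [if_neg hv] at hnoise
    linarith

theorem mulVec_mean (hu : IsFlowSolution M β S Z u) : M *ᵥ u mean = S *ᵥ u value := by
  ext v
  exact sub_eq_zero.1 (hu mean v nofun)

theorem mulVec_noise_sub_mean (hu : IsFlowSolution M β S Z u) :
    M *ᵥ (u noise - u mean) = u score := by
  rw [mulVec_sub, hu.mulVec_mean, hu.score_eq, hu.noise_eq, mulVec_mulVec, ← sub_mulVec]

theorem dual_eq (hu : IsFlowSolution M β S Z u) (hM : M.PosDef) :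
    u dual = u noise - u mean := by
  rw [← sub_eq_zero]
  refine eq_zero_of_posDef_of_mulVec_eq_zero_on hM (A := {v | v ∉ Z}) (fun v hv => ?_)
    fun v hv => ?_
  · have hdual := hu dual v nofun
    simp only [flowMap, LinearMap.coe_mk, AddHom.coe_mk, if_pos (not_not.1 hv)] at hdual
    simp only [Pi.sub_apply]
    linarith
  · have hdual := hu dual v nofun
    simp only [flowMap, LinearMap.coe_mk, AddHom.coe_mk, if_neg (show v ∉ Z from hv)] at hdual
    rw [mulVec_sub, hu.mulVec_noise_sub_mean, Pi.sub_apply, hdual]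

theorem mulVec_dual (hu : IsFlowSolution M β S Z u) (hM : M.PosDef) :
    M *ᵥ u dual = u score := by
  rw [hu.dual_eq hM, hu.mulVec_noise_sub_mean]

theorem mulVec_flowResidual (hu : IsFlowSolution M β S Z u) (h : G.IsParametrization Sg M β S) :
    Sg *ᵥ flowResidual β S u = u value := by
  have hdual := hu.mulVec_dual h.posDef
  have hscore := hu.score_eq
  have hcov := h.cov_eq
  set T := M * (1 - β) - S with hT
  have hres : flowResidual β S u = Tᵀ *ᵥ u dual := by
    have hMT : Mᵀ = M := h.posDef.isHermitian
    rw [hT, transpose_sub, transpose_mul, hMT, transpose_sub, transpose_one, sub_mulVec,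
      ← mulVec_mulVec, hdual, sub_mulVec, one_mulVec, flowResidual]
  have hdet : T.det ≠ 0 := fun h0 => h.posDef.det_pos.ne' (by simp [← hcov, h0])
  refine mulVec_injective_of_isUnit ((isUnit_iff_isUnit_det _).2 hdet.isUnit) ?_
  rw [hres, mulVec_mulVec, mulVec_mulVec, hcov, hdual, hscore]

end IsFlowSolution

theorem IsParametrization.flowMap_injective (h : G.IsParametrization Sg M β S) (hSg : Sg.PosDef) :
    Function.Injective (flowMap M β S Z) := by
  rw [injective_iff_map_eq_zero]
  intro u hu
  have hsol : IsFlowSolution M β S Z u := fun q v _ => congrFun₂ hu q v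
  have hres : flowResidual β S u = 0 := by
    refine eq_zero_of_posDef_of_mulVec_eq_zero_on hSg (A := Z) (fun v hv => ?_) fun v hv => ?_
    · simpa [flowMap, show v ∉ Z from hv] using congrFun₂ hu score v
    · rw [hsol.mulVec_flowResidual h]
      exact hsol.value_eq_zero hv
  have hMinj := mulVec_injective_of_isUnit h.posDef.isUnit
  have hvalue : u value = 0 := by rw [← hsol.mulVec_flowResidual h, hres, mulVec_zero]
  have hnoise : u noise = 0 := by rw [hsol.noise_eq, hvalue, mulVec_zero]
  have hscore : u score = 0 := by rw [hsol.score_eq, hvalue, mulVec_zero]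
  have hmean : u mean = 0 := hMinj (by simp only [hsol.mulVec_mean, hvalue, mulVec_zero])
  have hdual : u dual = 0 := by rw [hsol.dual_eq h.posDef, hnoise, hmean, sub_zero]
  ext q v
  cases q
  exacts [congrFun hvalue v, congrFun hnoise v, congrFun hscore v, congrFun hdual v,
    congrFun hmean v]

/-- The assignments of values to the unknowns that vanish outside `R`. -/
def flowSupported (R : Set (FlowKind × V)) : Submodule ℝ (FlowKind → V → ℝ) where
  carrier := {u | ∀ q v, (q, v) ∉ R → u q v = 0}
  add_mem' h h' q v hqv := by simp [h q v hqv, h' q v hqv]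
  zero_mem' _ _ _ := rfl
  smul_mem' c u h q v hqv := by simp [h q v hqv]

theorem IsParametrization.exists_isResidual_of_separated (h : G.IsParametrization Sg M β S)
    (hSg : Sg.PosDef) {X Y : Finset V} (hsep : G.Separated X Y Z) {x y : V} (hx : x ∈ X)
    (hy : y ∈ Y) (hxZ : x ∉ Z) : ∃ a, IsResidual Sg Z x a ∧ (Sg *ᵥ a) y = 0 := by
  set R : Set (FlowKind × V) := {t | Relation.ReflTransGen (G.FlowStep Z) (score, x) t}
  have hsource : Pi.single score (Pi.single x 1) ∈ flowSupported R := by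
    intro q v hqv
    rcases eq_or_ne q score with rfl | hq
    · rw [Pi.single_eq_same, Pi.single_eq_of_ne]
      rintro rfl
      exact hqv .refl
    · rw [Pi.single_eq_of_ne hq, Pi.zero_apply]
  obtain ⟨u, huR, hu⟩ := exists_mem_apply_eq_of_injective (h.flowMap_injective (Z := Z) hSg)
    (W := flowSupported R)
    (fun u => h.flowMap_apply_eq_zero (R := R) fun _ _ => Relation.ReflTransGen.tail) hsource
  have hsol : IsFlowSolution M β S Z u := by
    intro q v hqv
    rw [hu]
    rcases eq_or_ne q score with rfl | hq
    · rw [Pi.single_eq_same, Pi.single_eq_of_ne]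
      rintro rfl
      exact hxZ (hqv rfl)
    · rw [Pi.single_eq_of_ne hq, Pi.zero_apply]
  have hres : ∀ v ∉ Z, flowResidual β S u v = Pi.single (M := fun _ => ℝ) x 1 v := fun v hv => by
    simpa [flowMap, hv] using congrFun₂ hu score v
  refine ⟨flowResidual β S u, ⟨?_, fun v hvx hvZ => ?_, fun z hz => ?_⟩, ?_⟩
  · rw [hres x hxZ, Pi.single_eq_same]
  · rw [hres v hvZ, Pi.single_eq_of_ne hvx]
  · rw [hsol.mulVec_flowResidual h]
    exact hsol.value_eq_zero hz
  · rw [hsol.mulVec_flowResidual h]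
    exact huR _ _ fun hmem => not_separated_of_reflTransGen_flowStep hx hy hxZ hmem hsep

end UCG

namespace UCG

variable {V : Type*} {G : UCG V} {K : Finset V}

/-- The node `d` can be reached from the set `K` by a semidirected route whose first edge is an
arrow. -/
def StrictDescendant (G : UCG V) (K : Finset V) (d : V) : Prop :=
  ∃ k ∈ K, ∃ c, G.Arrow k c ∧
    Relation.ReflTransGen (fun c d => G.solid c d ∨ G.dashed c d ∨ G.und.Adj c d) c d

theorem StrictDescendant.und {c d : V} (h : G.StrictDescendant K c) (hcd : G.und.Adj c d) :
    G.StrictDescendant K d := by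
  obtain ⟨k, hk, b, hb, hbc⟩ := h
  exact ⟨k, hk, b, hb, hbc.tail (.inr (.inr hcd))⟩

theorem StrictDescendant.arrow {c d : V} (h : G.StrictDescendant K c) (hcd : G.Arrow c d) :
    G.StrictDescendant K d := by
  obtain ⟨k, hk, b, hb, hbc⟩ := h
  exact ⟨k, hk, b, hb, hbc.tail (or_assoc.1 (.inl hcd))⟩

theorem Arrow.strictDescendant {k d : V} (h : G.Arrow k d) (hk : k ∈ K) : G.StrictDescendant K d :=
  ⟨k, hk, d, h, .refl⟩

theorem reflTransGen_of_reachable {a b : V} (h : G.und.Reachable a b) :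
    Relation.ReflTransGen (fun c d => G.solid c d ∨ G.dashed c d ∨ G.und.Adj c d) a b :=
  Relation.ReflTransGen.mono (fun _ _ h => Or.inr (Or.inr h)) _ _
    ((SimpleGraph.reachable_iff_reflTransGen a b).1 h)

theorem StrictDescendant.reachable {c d : V} (h : G.StrictDescendant K c)
    (hcd : G.und.Reachable c d) : G.StrictDescendant K d := by
  obtain ⟨k, hk, b, hb, hbc⟩ := h
  exact ⟨k, hk, b, hb, hbc.trans (reflTransGen_of_reachable hcd)⟩

section Families

variable [Fintype V] {X : Finset V} {a b d : V}

theorem mem_Fa : b ∈ G.Fa X ↔ ∃ a ∈ X, G.solid b a := by simp [Fa]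

theorem mem_Mo : b ∈ G.Mo X ↔ ∃ a ∈ X, G.dashed b a := by simp [Mo]

theorem mem_Ne : b ∈ G.Ne X ↔ ∃ a ∈ X, G.und.Adj b a := by simp [Ne]

variable [DecidableEq V]

theorem mem_Pa : b ∈ G.Pa X ↔ ∃ a ∈ X, G.Arrow b a := by
  simp only [Pa, Finset.mem_union, mem_Fa, mem_Mo, Arrow, and_or_left, exists_or]

theorem mem_iff_reachable (hK : K ∈ G.Cc) (ha : a ∈ K) : b ∈ K ↔ G.und.Reachable a b := by
  obtain ⟨v, -, rfl⟩ := Finset.mem_image.1 hK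
  simp only [Finset.mem_filter, Finset.mem_univ, true_and] at ha ⊢
  exact ⟨ha.symm.trans, ha.trans⟩

theorem mem_of_und (hK : K ∈ G.Cc) (ha : a ∈ K) (h : G.und.Adj a b) : b ∈ K :=
  (mem_iff_reachable hK ha).2 h.reachable

theorem not_strictDescendant_of_mem (hK : K ∈ G.Cc) (hd : d ∈ K) : ¬ G.StrictDescendant K d := by
  rintro ⟨k, hk, c, hc, hcd⟩
  exact G.no_semidirected_cycle k c hc
    (hcd.trans (reflTransGen_of_reachable ((mem_iff_reachable hK hd).1 hk)))

theorem not_strictDescendant_of_mem_Pa (hK : K ∈ G.Cc) (hd : d ∈ G.Pa K) :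
    ¬ G.StrictDescendant K d := by
  obtain ⟨a, ha, hda⟩ := mem_Pa.1 hd
  exact fun h => not_strictDescendant_of_mem hK ha (h.arrow hda)

theorem not_strictDescendant_of_mem_union (hK : K ∈ G.Cc) (hd : d ∈ K ∪ G.Pa K) :
    ¬ G.StrictDescendant K d :=
  (Finset.mem_union.1 hd).elim (not_strictDescendant_of_mem hK) (not_strictDescendant_of_mem_Pa hK)

theorem disjoint_Pa (hK : K ∈ G.Cc) : Disjoint K (G.Pa K) :=
  Finset.disjoint_left.2 fun _ hd hdPa =>
    have ⟨_, ha, hda⟩ := mem_Pa.1 hdPa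
    not_strictDescendant_of_mem hK ha (hda.strictDescendant hd)

theorem not_mem_Mo_of_mem_Fa (hK : K ∈ G.Cc) (hd : d ∈ G.Fa K) : d ∉ G.Mo K := by
  intro hd'
  obtain ⟨a, ha, h⟩ := mem_Fa.1 hd
  obtain ⟨b, hb, h'⟩ := mem_Mo.1 hd'
  exact G.fathers_disjoint_mothers d a b ((mem_iff_reachable hK ha).1 hb) h h'

end Families

section Routes

variable {Z : Finset V} {n s t m : ℕ} {r : ℕ → V} {e f : Mark}

theorem SectionOpen.exists_mem_of_ne_tail (h : SectionOpen Z r s t e f) (hst : s ≤ t)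
    (he : e ≠ .tail) (hf : f ≠ .tail) : ∃ i, s ≤ i ∧ i ≤ t ∧ r i ∈ Z := by
  by_cases hef : e = .solid ∧ f = .solid
  · exact h.exists_mem hef.1 hef.2
  · rcases Mark.ne_tail_iff.1 he with rfl | rfl
    · exact ⟨s, le_rfl, hst, (h.mem_iff hef s le_rfl hst).2 (.inl ⟨rfl, rfl, .inr hf⟩)⟩
    · have hfd := (Mark.ne_tail_iff.1 hf).resolve_right fun hf => hef ⟨rfl, hf⟩
      exact ⟨t, hst, le_rfl, (h.mem_iff hef t hst le_rfl).2 (.inr ⟨rfl, hfd, .inr he⟩)⟩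

theorem exists_hasMark_of_arrow {a c : V} (h : G.Arrow a c) : ∃ m ≠ Mark.tail, G.HasMark a c m :=
  h.elim (fun h => ⟨.solid, nofun, h⟩) fun h => ⟨.dashed, nofun, h⟩

theorem IsOpen.exists_mem_of_arrows (ho : G.IsOpen Z n r) (hst : s ≤ t) (hs : 1 ≤ s)
    (ht : t + 1 ≤ n) (hund : ∀ i, s ≤ i → i < t → G.und.Adj (r i) (r (i + 1)))
    (hleft : G.Arrow (r (s - 1)) (r s)) (hright : G.Arrow (r (t + 1)) (r t)) :
    ∃ i, s ≤ i ∧ i ≤ t ∧ r i ∈ Z := by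
  obtain ⟨e, he, hes⟩ := exists_hasMark_of_arrow hleft
  obtain ⟨f, hf, hft⟩ := exists_hasMark_of_arrow hright
  exact (ho.sectionOpen ⟨hst, hund, .inr ⟨hs, hes⟩, .inr ⟨ht, hft⟩⟩).exists_mem_of_ne_tail hst he hf

theorem IsOpen.not_mem_of_arrow (h : G.IsOpen Z n r) (ht : t + 1 ≤ n)
    (ha : G.Arrow (r (t + 1)) (r t)) : r (t + 1) ∉ Z := by
  have hund := ha.not_und
  have hsymm := ha.not_symm
  refine h.2.2 (t + 1) ht ?_ ?_
  · rintro ⟨-, -, hc | hc⟩ <;> grind [ColliderTriple, Arrow]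
  · rintro ⟨j, k, ⟨-, -, -, hu, hleft, -⟩, hj, hk⟩
    rcases hj.eq_or_lt with rfl | hj
    · exact hsymm (.inl hleft)
    · exact hund (hu t (by omega) (by omega)).symm

theorem IsOpen.not_mem_of_und_of_not_dashed (h : G.IsOpen Z n r) (hn : 1 ≤ n)
    (h0 : G.und.Adj (r 0) (r 1)) (h1 : 2 ≤ n → ¬ G.dashed (r 2) (r 1)) : r 1 ∉ Z := by
  refine h.2.2 1 hn ?_ ?_
  · rintro ⟨-, hn2, hc | hc⟩
    · exact Arrow.not_und (.inr hc.1) h0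
    · exact h1 hn2 hc.1
  · rintro ⟨j, k, ⟨hj1, -, -, -, hleft, -⟩, hj, -⟩
    obtain rfl : j = 1 := by omega
    exact Arrow.not_und (.inl hleft) h0

/-- The route `r` enters position `j` by an arrow, continues to position `m` by undirected edges,
and visits only strict descendants of `K` on the way. -/
structure DescendsFrom (G : UCG V) (K : Finset V) (r : ℕ → V) (j m : ℕ) : Prop where
  pos : 1 ≤ j
  le : j ≤ m
  arrow : G.Arrow (r (j - 1)) (r j)
  und : ∀ i, j ≤ i → i < m → G.und.Adj (r i) (r (i + 1))
  strictDescendant : ∀ i, j ≤ i → i ≤ m → G.StrictDescendant K (r i)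

theorem descendsFrom_succ (h : G.Arrow (r m) (r (m + 1))) (hm : G.StrictDescendant K (r (m + 1))) :
    G.DescendsFrom K r (m + 1) (m + 1) where
  pos := by omega
  le := le_rfl
  arrow := h
  und i hi hi' := by omega
  strictDescendant i hi hi' := by rwa [show i = m + 1 by omega]

theorem DescendsFrom.extend_und {j : ℕ} (h : G.DescendsFrom K r j m)
    (hu : G.und.Adj (r m) (r (m + 1))) : G.DescendsFrom K r j (m + 1) where
  pos := h.pos
  le := h.le.trans m.le_succ
  arrow := h.arrow
  und i hi hi' := by
    rcases Nat.lt_succ_iff_lt_or_eq.1 hi' with hi' | rfl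
    exacts [h.und i hi hi', hu]
  strictDescendant i hi hi' := by
    rcases hi'.lt_or_eq with hi' | rfl
    · exact h.strictDescendant i hi (by omega)
    · exact (h.strictDescendant m h.le le_rfl).und hu

theorem Adjacent.und_or_arrow {a b : V} (h : G.Adjacent a b) :
    G.und.Adj a b ∨ G.Arrow a b ∨ G.Arrow b a := by
  unfold Adjacent at h
  unfold Arrow
  tauto

theorem IsOpen.strictDescendant_of_arrow (ho : G.IsOpen Z n r) (hr : G.IsRoute n r)
    (hZ : ∀ d ∈ Z, ¬ G.StrictDescendant K d) (ht : t < n) (htK : r t ∈ K)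
    (ha : G.Arrow (r t) (r (t + 1))) : G.StrictDescendant K (r n) := by
  suffices key : ∀ m, t + 1 ≤ m → m ≤ n → ∃ j, G.DescendsFrom K r j m by
    obtain ⟨j, hj⟩ := key n ht le_rfl
    exact hj.strictDescendant n hj.le le_rfl
  intro m htm
  induction m, htm using Nat.le_induction with
  | base => exact fun _ => ⟨t + 1, descendsFrom_succ ha (ha.strictDescendant htK)⟩
  | succ m _ ih =>
    intro hm
    obtain ⟨j, hj⟩ := ih (by omega)
    rcases (hr m hm).und_or_arrow with hu | hout | hin
    · exact ⟨j, hj.extend_und hu⟩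
    · exact ⟨m + 1, descendsFrom_succ hout ((hj.strictDescendant m hj.le le_rfl).arrow hout)⟩
    · obtain ⟨i, hji, him, hi⟩ := ho.exists_mem_of_arrows hj.le hj.pos hm hj.und hj.arrow hin
      exact absurd (hj.strictDescendant i hji him) (hZ _ hi)

variable [Fintype V] [DecidableEq V]

theorem mem_of_forall_und (hK : K ∈ G.Cc) (h0 : r 0 ∈ K)
    (hu : ∀ s < m, G.und.Adj (r s) (r (s + 1))) : r m ∈ K := by
  induction m with
  | zero => exact h0
  | succ m ih => exact mem_of_und hK (ih fun s hs => hu s (by omega)) (hu m (by omega))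

theorem IsOpen.exists_forall_und_arrow (ho : G.IsOpen Z n r) (hr : G.IsRoute n r) (hK : K ∈ G.Cc)
    (h0 : r 0 ∈ K) (hZ : ∀ d ∈ Z, ¬ G.StrictDescendant K d) (hn : ¬ G.StrictDescendant K (r n)) :
    ∃ t ≤ n, (∀ s < t, G.und.Adj (r s) (r (s + 1))) ∧ r t ∈ K ∧
      (t < n → G.Arrow (r (t + 1)) (r t)) := by
  classical
  by_cases hall : ∀ s < n, G.und.Adj (r s) (r (s + 1))
  · exact ⟨n, le_rfl, hall, mem_of_forall_und hK h0 hall, fun h => absurd h (lt_irrefl n)⟩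
  · push Not at hall
    obtain ⟨ht, hnot⟩ := Nat.find_spec hall
    have hund : ∀ s < Nat.find hall, G.und.Adj (r s) (r (s + 1)) := fun s hs =>
      by_contra fun hs' => Nat.find_min hall hs ⟨hs.trans ht, hs'⟩
    have htK := mem_of_forall_und hK h0 hund
    refine ⟨_, ht.le, hund, htK, fun _ => ?_⟩
    refine ((hr _ ht).und_or_arrow.resolve_left hnot).resolve_left fun ha => hn ?_
    exact ho.strictDescendant_of_arrow hr hZ ht htK ha

theorem IsOpen.eq_of_arrow (ho : G.IsOpen Z n r) {j : V} (hZ : G.Pa K \ {j} ⊆ Z) (ht : t < n)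
    (htK : r t ∈ K) (ha : G.Arrow (r (t + 1)) (r t)) : r (t + 1) = j := by
  by_contra hne
  refine ho.not_mem_of_arrow ht ha (hZ (Finset.mem_sdiff.2 ⟨mem_Pa.2 ⟨r t, htK, ha⟩, ?_⟩))
  rwa [Finset.mem_singleton]

theorem separated_Pa (hK : K ∈ G.Cc) {Y : Finset V}
    (hY : ∀ y ∈ Y, y ∉ K ∧ ¬ G.StrictDescendant K y) : G.Separated K Y (G.Pa K) := by
  rintro ⟨n, r, hr, h0, hn, ho⟩
  obtain ⟨hnK, hnd⟩ := hY _ hn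
  obtain ⟨t, ht, -, htK, ha⟩ := ho.exists_forall_und_arrow hr hK h0
    (fun d hd => not_strictDescendant_of_mem_Pa hK hd) hnd
  have ht : t < n := ht.lt_of_ne (by rintro rfl; exact hnK htK)
  exact ho.not_mem_of_arrow ht (ha ht) (mem_Pa.2 ⟨r t, htK, ha ht⟩)

theorem separated_mother (hK : K ∈ G.Cc) {i j : V} (hi : i ∈ K) (hj : j ∈ G.Mo K)
    (hij : ¬ G.dashed j i) : G.Separated {i} {j} (G.Pa K \ {j}) := by
  rintro ⟨n, r, hr, h0, hn, ho⟩
  rw [Finset.mem_singleton] at h0 hn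
  have hjPa : j ∈ G.Pa K := Finset.mem_union_right _ hj
  obtain ⟨t, ht, hu, htK, ha⟩ := ho.exists_forall_und_arrow hr hK (h0 ▸ hi)
    (fun d hd => not_strictDescendant_of_mem_Pa hK (Finset.mem_sdiff.1 hd).1)
    (hn ▸ not_strictDescendant_of_mem_Pa hK hjPa)
  have htPa := Finset.disjoint_left.1 (disjoint_Pa hK) htK
  have ht : t < n := ht.lt_of_ne (by rintro rfl; exact htPa (hn ▸ hjPa))
  have hrj : r (t + 1) = j := ho.eq_of_arrow subset_rfl ht htK (ha ht)
  have hdashed : G.dashed j (r t) := (hrj ▸ ha ht).resolve_left fun hs =>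
    not_mem_Mo_of_mem_Fa hK (mem_Fa.2 ⟨_, htK, hs⟩) hj
  rcases Nat.eq_zero_or_pos t with rfl | ht0
  · exact hij (h0 ▸ hdashed)
  · have hpred := hu (t - 1) (by omega)
    rw [Nat.sub_add_cancel (by omega)] at hpred
    have hcollider := ho.1 t ⟨ht0, ht, .inr ⟨by rwa [hrj], .inr (.inl hpred.symm)⟩⟩
    exact htPa (Finset.mem_sdiff.1 hcollider).1

theorem IsOpen.dashed_of_und (ho : G.IsOpen Z n r) (hK : K ∈ G.Cc) (h0 : r 0 ∈ K) {j : V}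
    (hZ : K \ {r 0, j} ⊆ Z) (hj : ¬ G.und.Adj (r 0) j) (hn : 1 ≤ n)
    (hu : G.und.Adj (r 0) (r 1)) : 2 ≤ n ∧ G.dashed (r 2) (r 1) := by
  by_contra hcon
  refine ho.not_mem_of_und_of_not_dashed hn hu (fun h2 h3 => hcon ⟨h2, h3⟩) (hZ ?_)
  have hne : r 1 ≠ j := by
    rintro rfl
    exact hj hu
  simp [mem_of_und hK h0 hu, hu.ne', hne]

theorem separated_nonadjacent (hK : K ∈ G.Cc) {i j : V} (hi : i ∈ K) (hj : j ∈ K ∪ G.Pa K)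
    (hne : i ≠ j) (hund : ¬ G.und.Adj i j) (hsolid : ¬ G.solid j i) (hjMo : j ∉ G.Mo K) :
    G.Separated {i} {j} ((K ∪ G.Pa K) \ {i, j}) := by
  rintro ⟨n, r, hr, h0, hn, ho⟩
  rw [Finset.mem_singleton] at h0 hn
  subst h0
  have hPa : G.Pa K \ {j} ⊆ (K ∪ G.Pa K) \ {r 0, j} := by
    have := Finset.disjoint_left.1 (disjoint_Pa hK) hi
    grind
  have hn1 : 1 ≤ n := Nat.one_le_iff_ne_zero.2 (by rintro rfl; exact hne hn)
  have hfirst := ho.dashed_of_und hK hi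
    (Finset.sdiff_subset_sdiff Finset.subset_union_left subset_rfl) hund hn1
  obtain ⟨t, ht, hu, htK, ha⟩ := ho.exists_forall_und_arrow hr hK hi
    (fun d hd => not_strictDescendant_of_mem_union hK (Finset.mem_sdiff.1 hd).1)
    (hn ▸ not_strictDescendant_of_mem_union hK hj)
  rcases Nat.eq_zero_or_pos t with rfl | ht0
  · have ha := ha hn1
    rw [ho.eq_of_arrow hPa hn1 hi ha] at ha
    exact ha.elim hsolid fun ha => hjMo (mem_Mo.2 ⟨r 0, hi, ha⟩)
  · obtain ⟨h2n, hdashed⟩ := hfirst (hu 0 ht0)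
    have h1K : r 1 ∈ K := mem_of_und hK hi (hu 0 ht0)
    have h2j : r 2 = j := ho.eq_of_arrow hPa h2n h1K (.inr hdashed)
    exact hjMo (mem_Mo.2 ⟨r 1, h1K, h2j ▸ hdashed⟩)

end Routes

end UCG

section Precision

open Matrix

variable {V : Type*} {p : Measure (V → ℝ)}

theorem covMat_comm (i j : V) : covMat p i j = covMat p j i := covariance_comm _ _

variable [Fintype V]

theorem IsResidual.mulVec_self_pos {S : Matrix V V ℝ} (hS : S.PosDef) {Z : Finset V} {i : V}
    {a : V → ℝ} (ha : IsResidual S Z i a) : 0 < (S *ᵥ a) i := by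
  classical
  have hne : a ≠ 0 := fun h => one_ne_zero (ha.apply_self.symm.trans (congrFun h i))
  have hquad : star a ⬝ᵥ S *ᵥ a = (S *ᵥ a) i := by
    rw [dotProduct, Finset.sum_eq_single i, Pi.star_apply, ha.apply_self, star_one, one_mul]
    · intro v _ hv
      by_cases hvZ : v ∈ Z
      · rw [ha.mulVec_eq_zero v hvZ, mul_zero]
      · rw [Pi.star_apply, ha.apply_eq_zero v hv hvZ, star_zero, zero_mul]
    · exact fun h => absurd (Finset.mem_univ i) h
  exact hquad ▸ hS.dotProduct_mulVec_pos hne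

variable [DecidableEq V]

theorem IsResidual.condCov_eq (hp : (covMat p).PosDef) {K P : Finset V} (i j : K) {a : V → ℝ}
    (ha : IsResidual (covMat p) P i a) (hi : (i : V) ∉ P) :
    condCov p K P i j = (covMat p *ᵥ a) j := by
  have hcond : condCov p K P = covBlock p K K - regCoef p K P * covBlock p P K := rfl
  rw [hcond, Matrix.sub_apply, mul_apply, mulVec, dotProduct_comm, ha.dotProduct_eq hi,
    sub_eq_add_neg, ← Finset.sum_neg_distrib]
  simp only [ha.regCoef_eq hp i _ hi, neg_mul, neg_neg, covMat_comm (j : V), covBlock,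
    submatrix_apply]

theorem margPrecision_eq_of_mulVec (hp : (covMat p).PosDef) {A : Finset V} {w : V → ℝ} {i : A}
    (hsupp : ∀ v ∉ A, w v = 0)
    (hw : ∀ v : A, (covMat p *ᵥ w) v = (Pi.single i 1 : A → ℝ) v) (j : A) :
    margPrecision p A i j = w j := by
  have hrow : (fun v : A => w v) ᵥ* covBlock p A A = Pi.single i 1 := by
    ext v
    rw [← hw v, mulVec, dotProduct_comm, dotProduct,
      ← Finset.sum_subset (Finset.subset_univ A) fun u _ hu => by rw [hsupp u hu, zero_mul],
      ← Finset.sum_coe_sort]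
    simp only [vecMul, dotProduct, covBlock, submatrix_apply, covMat_comm (v : V)]
  calc margPrecision p A i j = (Pi.single i 1 ᵥ* (covBlock p A A)⁻¹) j := by
        rw [single_one_vecMul]; rfl
    _ = w j := by
      rw [← hrow, vecMul_vecMul, mul_nonsing_inv _ (isUnit_det_covBlock hp A), vecMul_one]

theorem IsResidual.margPrecision_eq_zero (hp : (covMat p).PosDef) {A : Finset V} {i j : A}
    (hij : i ≠ j) {a : V → ℝ} (ha : IsResidual (covMat p) (A \ {(i : V), (j : V)}) i a)
    (hj : (covMat p *ᵥ a) j = 0) : margPrecision p A i j = 0 := by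
  have hpos := ha.mulVec_self_pos hp
  have haj : a j = 0 := ha.apply_eq_zero j (Subtype.coe_injective.ne hij.symm) (by simp)
  rw [margPrecision_eq_of_mulVec hp (w := ((covMat p *ᵥ a) i)⁻¹ • a), Pi.smul_apply, haj,
    smul_zero]
  · intro v hv
    rw [Pi.smul_apply, ha.apply_eq_zero v (fun h => hv (h ▸ i.2))
      (fun h => hv (Finset.mem_sdiff.1 h).1), smul_zero]
  · intro v
    rw [mulVec_smul, Pi.smul_apply, smul_eq_mul]
    rcases eq_or_ne v i with rfl | hvi
    · rw [inv_mul_cancel₀ hpos.ne', Pi.single_eq_same]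
    · rw [Pi.single_eq_of_ne hvi]
      rcases eq_or_ne v j with rfl | hvj
      · rw [hj, mul_zero]
      · rw [ha.mulVec_eq_zero v (by simp [hvi, hvj]), mul_zero]

theorem IsResidual.of_sdiff_singleton {S : Matrix V V ℝ} {Z : Finset V} {i j : V} {a : V → ℝ}
    (ha : IsResidual S (Z \ {j}) i a) (hj : (S *ᵥ a) j = 0) : IsResidual S Z i a where
  apply_self := ha.apply_self
  apply_eq_zero v hvi hvZ := ha.apply_eq_zero v hvi fun h => hvZ (Finset.mem_sdiff.1 h).1
  mulVec_eq_zero z hz := by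
    rcases eq_or_ne z j with rfl | hzj
    · exact hj
    · exact ha.mulVec_eq_zero z (by simp [hz, hzj])

end Precision

namespace UCG

open Matrix

variable {V : Type*} [Fintype V] {G : UCG V}

section Component

variable {v w : V}

open Classical in
/-- The chain component of the node `v`. -/
noncomputable def component (G : UCG V) (v : V) : Finset V :=
  Finset.univ.filter fun w => G.und.Reachable v w

theorem mem_component : w ∈ G.component v ↔ G.und.Reachable v w := by simp [component]

theorem self_mem_component : v ∈ G.component v := mem_component.2 .rfl

theorem mem_component_comm : w ∈ G.component v ↔ v ∈ G.component w := by
  rw [mem_component, mem_component, SimpleGraph.reachable_comm]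

theorem component_eq_of_mem (h : w ∈ G.component v) : G.component w = G.component v := by
  ext u
  rw [mem_component, mem_component]
  exact ⟨(mem_component.1 h).trans, (mem_component.1 h).symm.trans⟩

variable [DecidableEq V]

theorem component_mem_Cc (v : V) : G.component v ∈ G.Cc :=
  Finset.mem_image.2 ⟨v, Finset.mem_univ v, by ext; simp [component]⟩

theorem component_eq {K : Finset V} (hK : K ∈ G.Cc) (hv : v ∈ K) : G.component v = K := by
  ext w
  rw [mem_component, mem_iff_reachable hK hv]

theorem not_mem_Pa_component (v : V) : v ∉ G.Pa (G.component v) :=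
  Finset.disjoint_left.1 (disjoint_Pa (component_mem_Cc v)) self_mem_component

theorem sum_sum_Cc {M : Type*} [AddCommMonoid M] (f : V → M) :
    ∑ K ∈ G.Cc, ∑ i ∈ K, f i = ∑ i, f i := by
  rw [← Finset.sum_biUnion]
  · refine Finset.sum_congr (Finset.eq_univ_iff_forall.2 fun v => ?_) fun _ _ => rfl
    exact Finset.mem_biUnion.2 ⟨_, component_mem_Cc v, self_mem_component⟩
  · intro K hK K' hK' hne
    exact Finset.disjoint_left.2 fun v hv hv' =>
      hne ((component_eq hK hv).symm.trans (component_eq hK' hv'))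

end Component

theorem StrictDescendant.not_symm {i j : V} (h : G.StrictDescendant (G.component i) j) :
    ¬ G.StrictDescendant (G.component j) i := by
  classical
  rintro ⟨l, hl, d, hld, hdi⟩
  obtain ⟨k, hk, b, hb, hbl⟩ := h.reachable (mem_component.1 hl)
  exact not_strictDescendant_of_mem (component_mem_Cc i) self_mem_component
    ⟨k, hk, b, hb, hbl.trans (.head (or_assoc.1 (.inl hld)) hdi)⟩

section Ancestors

open Classical in
/-- The number of nodes from which there is a semidirected route to `v`. -/
noncomputable def ancestorCard (G : UCG V) (v : V) : ℕ :=
  (Finset.univ.filter fun u =>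
    Relation.ReflTransGen (fun c d => G.solid c d ∨ G.dashed c d ∨ G.und.Adj c d) u v).card

theorem ancestorCard_lt [DecidableEq V] {i j : V} (h : j ∈ G.Pa (G.component i)) :
    G.ancestorCard j < G.ancestorCard i := by
  classical
  obtain ⟨c, hc, hjc⟩ := mem_Pa.1 h
  have hci := reflTransGen_of_reachable (mem_component.1 hc).symm
  refine Finset.card_lt_card ⟨fun u hu => ?_, fun hsub => ?_⟩
  · refine Finset.mem_filter.2 ⟨Finset.mem_univ u, (Finset.mem_filter.1 hu).2.trans ?_⟩
    exact .head (or_assoc.1 (.inl hjc)) hci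
  · have hij := hsub (Finset.mem_filter.2 ⟨Finset.mem_univ i, .refl⟩)
    exact G.no_semidirected_cycle j c hjc (hci.trans (Finset.mem_filter.1 hij).2)

end Ancestors

section ResidualMatrix

variable [DecidableEq V] {p : Measure (V → ℝ)} {i j v : V} {K : Finset V}

/-- The matrix of the coefficients `β_K` of the regressions of the chain components on their
parents. -/
noncomputable def parentCoef (G : UCG V) (p : Measure (V → ℝ)) : Matrix V V ℝ :=
  of fun i j => if h : j ∈ G.Pa (G.component i) then
    regCoef p (G.component i) (G.Pa (G.component i)) ⟨i, self_mem_component⟩ ⟨j, h⟩ else 0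

/-- The matrix that maps the coordinates to the residuals of their regressions on the parents of
their chain components. -/
noncomputable def residualMatrix (G : UCG V) (p : Measure (V → ℝ)) : Matrix V V ℝ :=
  1 - parentCoef G p

/-- The covariance matrix of the residuals of all chain components. -/
noncomputable def residualCov (G : UCG V) (p : Measure (V → ℝ)) : Matrix V V ℝ :=
  residualMatrix G p * covMat p * (residualMatrix G p)ᵀ

theorem parentCoef_apply (hK : K ∈ G.Cc) (i : K) (j : G.Pa K) :
    parentCoef G p i j = regCoef p K (G.Pa K) i j := by
  obtain ⟨i, hi⟩ := i
  obtain rfl := component_eq hK hi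
  exact dif_pos j.2

theorem parentCoef_eq_zero (h : j ∉ G.Pa (G.component i)) : parentCoef G p i j = 0 := dif_neg h

theorem isResidual_residualMatrix (hp : (covMat p).PosDef) (i : V) :
    IsResidual (covMat p) (G.Pa (G.component i)) i (residualMatrix G p i) := by
  have hi := not_mem_Pa_component (G := G) i
  obtain ⟨a, ha⟩ := exists_isResidual hp hi
  suffices residualMatrix G p i = a from this ▸ ha
  ext j
  rw [residualMatrix, Matrix.sub_apply]
  by_cases hj : j ∈ G.Pa (G.component i)
  · rw [one_apply_ne (by rintro rfl; exact hi hj),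
      parentCoef_apply (component_mem_Cc i) ⟨i, self_mem_component⟩ ⟨j, hj⟩,
      ha.regCoef_eq hp _ _ hi, zero_sub, neg_neg]
  · rw [parentCoef_eq_zero hj, sub_zero]
    rcases eq_or_ne i j with rfl | hij
    · rw [one_apply_eq, ha.apply_self]
    · rw [one_apply_ne hij, ha.apply_eq_zero j hij.symm hj]

theorem residualMatrix_apply_of_ancestorCard_le (hij : i ≠ j)
    (h : G.ancestorCard i ≤ G.ancestorCard j) : residualMatrix G p i j = 0 := by
  rw [residualMatrix, Matrix.sub_apply, one_apply_ne hij, zero_sub, neg_eq_zero]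
  exact parentCoef_eq_zero fun hj => (ancestorCard_lt hj).not_ge h

theorem residualMatrix_apply_self (i : V) : residualMatrix G p i i = 1 := by
  rw [residualMatrix, Matrix.sub_apply, one_apply_eq, parentCoef_eq_zero (not_mem_Pa_component i),
    sub_zero]

theorem det_residualMatrix : (residualMatrix G p).det = 1 := by
  have htri : (residualMatrix G p)ᵀ.BlockTriangular G.ancestorCard := fun i j hij =>
    residualMatrix_apply_of_ancestorCard_le (by rintro rfl; exact hij.false) hij.le
  rw [← det_transpose, htri.det]
  refine Finset.prod_eq_one fun n _ => ?_
  suffices (residualMatrix G p)ᵀ.toSquareBlock G.ancestorCard n = 1 by rw [this, det_one]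
  ext ⟨i, hi⟩ ⟨j, hj⟩
  rw [toSquareBlock_def, of_apply, transpose_apply]
  rcases eq_or_ne i j with rfl | hij
  · rw [one_apply_eq, residualMatrix_apply_self]
  · rw [one_apply_ne (by simpa using hij),
      residualMatrix_apply_of_ancestorCard_le hij.symm (hj.trans hi.symm).le]

theorem residualCov_transpose : (residualCov G p)ᵀ = residualCov G p := by
  rw [residualCov, transpose_mul, transpose_mul, transpose_transpose, covMat_transpose,
    Matrix.mul_assoc]

theorem residualCov_comm (i j : V) : residualCov G p i j = residualCov G p j i :=
  congrFun (congrFun residualCov_transpose j) i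

theorem residualCov_apply (i j : V) :
    residualCov G p i j = residualMatrix G p i ⬝ᵥ covMat p *ᵥ residualMatrix G p j := by
  rw [residualCov, Matrix.mul_assoc]
  rfl

theorem residualCov_apply_of_mem_component (hp : (covMat p).PosDef) (hj : j ∈ G.component i) :
    residualCov G p i j = (covMat p *ᵥ residualMatrix G p j) i := by
  have hi := isResidual_residualMatrix (G := G) hp i
  rw [residualCov_apply, hi.dotProduct_eq (not_mem_Pa_component i), add_eq_left]
  refine Finset.sum_eq_zero fun v _ => ?_
  rw [(isResidual_residualMatrix hp j).mulVec_eq_zero v (by rw [component_eq_of_mem hj]; exact v.2),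
    mul_zero]

theorem posDef_residualCov (hp : (covMat p).PosDef) : (residualCov G p).PosDef := by
  have hunit : IsUnit (residualMatrix G p) :=
    (isUnit_iff_isUnit_det _).2 (by rw [det_residualMatrix]; exact isUnit_one)
  rw [residualCov, ← conjTranspose_eq_transpose_of_trivial]
  exact hp.mul_mul_conjTranspose_same (vecMul_injective_iff_isUnit.2 hunit)

theorem condCov_eq_submatrix (hp : (covMat p).PosDef) (hK : K ∈ G.Cc) :
    condCov p K (G.Pa K) = (residualCov G p).submatrix ((↑) : K → V) (↑) := by
  ext i j
  have hcomp := component_eq hK i.2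
  have hres := isResidual_residualMatrix (G := G) hp (i : V)
  rw [hcomp] at hres
  rw [hres.condCov_eq hp i j (Finset.disjoint_left.1 (disjoint_Pa hK) i.2), submatrix_apply,
    residualCov_comm, residualCov_apply_of_mem_component hp]
  rw [component_eq hK j.2]
  exact i.2

theorem posDef_condCov (hp : (covMat p).PosDef) (hK : K ∈ G.Cc) :
    (condCov p K (G.Pa K)).PosDef := by
  rw [condCov_eq_submatrix hp hK]
  exact (posDef_residualCov hp).submatrix Subtype.val_injective

end ResidualMatrix

section CondPrecision

variable [DecidableEq V] {p : Measure (V → ℝ)} {i j v : V} {K : Finset V}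

/-- The block diagonal matrix with the blocks `Λ_K⁻¹`. -/
noncomputable def condPrecision (G : UCG V) (p : Measure (V → ℝ)) : Matrix V V ℝ :=
  of fun i j => if h : j ∈ G.component i then
    (condCov p (G.component i) (G.Pa (G.component i)))⁻¹ ⟨i, self_mem_component⟩ ⟨j, h⟩ else 0

theorem condPrecision_apply (hK : K ∈ G.Cc) (i j : K) :
    condPrecision G p i j = (condCov p K (G.Pa K))⁻¹ i j := by
  obtain ⟨i, hi⟩ := i
  obtain rfl := component_eq hK hi
  exact dif_pos j.2

theorem condPrecision_eq_zero (h : j ∉ G.component i) : condPrecision G p i j = 0 := dif_neg h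

theorem condPrecision_comm (hp : (covMat p).PosDef) (i j : V) :
    condPrecision G p i j = condPrecision G p j i := by
  by_cases hj : j ∈ G.component i
  · have hK := component_mem_Cc (G := G) i
    rw [condPrecision_apply hK ⟨j, hj⟩ ⟨i, self_mem_component⟩,
      condPrecision_apply hK ⟨i, self_mem_component⟩ ⟨j, hj⟩]
    exact ((posDef_condCov hp hK).inv.isHermitian.apply _ _).symm
  · rw [condPrecision_eq_zero hj, condPrecision_eq_zero fun h => hj (mem_component_comm.1 h)]

theorem condPrecision_transpose (hp : (covMat p).PosDef) :
    (condPrecision G p)ᵀ = condPrecision G p := by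
  ext i j
  exact condPrecision_comm hp j i

open Classical in
/-- The block diagonal part of the matrix `A` with respect to the chain components. -/
noncomputable def blockPart (G : UCG V) (A : Matrix V V ℝ) : Matrix V V ℝ :=
  of fun i j => if j ∈ G.component i then A i j else 0

theorem blockPart_apply_of_mem {A : Matrix V V ℝ} (h : j ∈ G.component i) :
    G.blockPart A i j = A i j := if_pos h

theorem blockPart_apply_of_not_mem {A : Matrix V V ℝ} (h : j ∉ G.component i) :
    G.blockPart A i j = 0 := if_neg h

theorem blockPart_residualCov_mul_condPrecision (hp : (covMat p).PosDef) :
    G.blockPart (residualCov G p) * condPrecision G p = 1 := by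
  ext i j
  have hK := component_mem_Cc (G := G) i
  have hsum : (G.blockPart (residualCov G p) * condPrecision G p) i j =
      ∑ k : G.component i, residualCov G p i k * condPrecision G p k j := by
    rw [mul_apply, Finset.sum_coe_sort _ fun k => residualCov G p i k * condPrecision G p k j]
    refine (Finset.sum_subset_zero_on_sdiff (Finset.subset_univ _) (fun k hk => ?_)
      fun k hk => ?_).symm
    · rw [blockPart_apply_of_not_mem (Finset.mem_sdiff.1 hk).2, zero_mul]
    · rw [blockPart_apply_of_mem hk]
  rw [hsum]
  by_cases hj : j ∈ G.component i
  · have hinv := congrFun (congrFun (mul_nonsing_inv _ (posDef_condCov hp hK).det_pos.ne'.isUnit)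
      ⟨i, self_mem_component⟩) ⟨j, hj⟩
    simp only [mul_apply, ← condPrecision_apply hK] at hinv
    rw [condCov_eq_submatrix hp hK] at hinv
    simpa [one_apply] using hinv
  · rw [one_apply_ne (by rintro rfl; exact hj self_mem_component)]
    refine Finset.sum_eq_zero fun k _ => ?_
    rw [condPrecision_eq_zero (by rwa [component_eq_of_mem k.2]), mul_zero]

theorem condPrecision_mul_residualMatrix_eq_zero (hv : v ∉ G.component i)
    (hvPa : v ∉ G.Pa (G.component i)) : (condPrecision G p * residualMatrix G p) i v = 0 := by
  rw [mul_apply]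
  refine Finset.sum_eq_zero fun k _ => ?_
  by_cases hk : k ∈ G.component i
  · rw [residualMatrix, Matrix.sub_apply, one_apply_ne (by rintro rfl; exact hv hk),
      parentCoef_eq_zero (by rwa [component_eq_of_mem hk]), sub_zero, mul_zero]
  · rw [condPrecision_eq_zero hk, zero_mul]

theorem condPrecision_mul_residualMatrix_apply (hj : j ∈ G.component i) :
    (condPrecision G p * residualMatrix G p) i j = condPrecision G p i j := by
  rw [mul_apply, Finset.sum_eq_single j, residualMatrix_apply_self, mul_one]
  · intro k _ hkj
    by_cases hk : k ∈ G.component i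
    · have hjPa := not_mem_Pa_component (G := G) j
      rw [component_eq_of_mem hj, ← component_eq_of_mem hk] at hjPa
      rw [residualMatrix, Matrix.sub_apply, one_apply_ne hkj, parentCoef_eq_zero hjPa, sub_zero,
        mul_zero]
    · rw [condPrecision_eq_zero hk, zero_mul]
  · exact fun h => absurd (Finset.mem_univ j) h

theorem covMat_mulVec_condPrecision_mul_residualMatrix (hp : (covMat p).PosDef)
    (hv : v ∈ G.component i ∪ G.Pa (G.component i)) :
    (covMat p *ᵥ (condPrecision G p * residualMatrix G p) i) v = (1 : Matrix V V ℝ) v i := by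
  have hsum : (covMat p *ᵥ (condPrecision G p * residualMatrix G p) i) v =
      ∑ k, (covMat p *ᵥ residualMatrix G p k) v * condPrecision G p k i := by
    rw [mul_apply_eq_vecMul, ← mulVec_transpose, mulVec_mulVec]
    exact Finset.sum_congr rfl fun k _ => by rw [condPrecision_comm hp k i]; rfl
  rw [hsum]
  rcases Finset.mem_union.1 hv with hvi | hvPa
  · rw [← blockPart_residualCov_mul_condPrecision (G := G) hp, mul_apply]
    refine Finset.sum_congr rfl fun k _ => ?_
    by_cases hk : k ∈ G.component v
    · rw [blockPart_apply_of_mem hk, residualCov_apply_of_mem_component hp hk]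
    · rw [condPrecision_comm hp, condPrecision_eq_zero, mul_zero, mul_zero]
      rwa [← component_eq_of_mem hvi]
  · rw [one_apply_ne (by rintro rfl; exact not_mem_Pa_component v hvPa)]
    refine Finset.sum_eq_zero fun k _ => ?_
    by_cases hk : k ∈ G.component i
    · rw [(isResidual_residualMatrix hp k).mulVec_eq_zero v (by rwa [component_eq_of_mem hk]),
        zero_mul]
    · rw [condPrecision_comm hp, condPrecision_eq_zero hk, mul_zero]

theorem margPrecision_apply (hp : (covMat p).PosDef) (hK : K ∈ G.Cc)
    (i j : (K ∪ G.Pa K : Finset V)) (hi : (i : V) ∈ K) :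
    margPrecision p (K ∪ G.Pa K) i j = (condPrecision G p * residualMatrix G p) i j := by
  have hcomp := component_eq hK hi
  refine margPrecision_eq_of_mulVec hp (fun v hv => ?_) (fun v => ?_) j
  · rw [Finset.mem_union, not_or, ← hcomp] at hv
    exact condPrecision_mul_residualMatrix_eq_zero hv.1 hv.2
  · rw [covMat_mulVec_condPrecision_mul_residualMatrix hp (by rw [hcomp]; exact v.2)]
    simp only [one_apply, Pi.single_apply, Subtype.ext_iff]

end CondPrecision

end UCG

section GaussianMarginals

open Matrix

variable {ι κ : Type*} [Fintype ι] [Fintype κ] [DecidableEq ι] [DecidableEq κ]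

theorem gaussianDensity_comp_equiv (e : κ ≃ ι) (m : ι → ℝ) (S : Matrix ι ι ℝ) (x : ι → ℝ) :
    gaussianDensity (m ∘ e) (S.submatrix e e) (x ∘ e) = gaussianDensity m S x := by
  have hsub : x ∘ e - m ∘ e = (x - m) ∘ e := rfl
  rw [gaussianDensity, gaussianDensity, Fintype.card_congr e, det_submatrix_equiv_self,
    inv_submatrix_equiv, hsub, submatrix_mulVec_equiv, Function.comp_assoc, Equiv.self_comp_symm,
    Function.comp_id, comp_equiv_dotProduct_comp_equiv]

theorem dotProduct_inv_fromBlocks_mulVec {A : Matrix ι ι ℝ} {B : Matrix ι κ ℝ} {D : Matrix κ κ ℝ}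
    (hD : IsUnit D) (hDsymm : Dᵀ = D) (hL : IsUnit (A - B * D⁻¹ * Bᵀ)) (x : ι → ℝ) (y : κ → ℝ) :
    Sum.elim x y ⬝ᵥ (fromBlocks A B Bᵀ D)⁻¹ *ᵥ Sum.elim x y =
      (x - (B * D⁻¹) *ᵥ y) ⬝ᵥ (A - B * D⁻¹ * Bᵀ)⁻¹ *ᵥ (x - (B * D⁻¹) *ᵥ y) + y ⬝ᵥ D⁻¹ *ᵥ y := by
  obtain ⟨_⟩ := hD.nonempty_invertible
  obtain ⟨_⟩ := hL.nonempty_invertible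
  let _ : Invertible (A - B * ⅟D * Bᵀ) := by
    rw [invOf_eq_nonsing_inv]
    assumption
  let _ := fromBlocks₂₂Invertible A B Bᵀ D
  have hinv := invOf_fromBlocks₂₂_eq A B Bᵀ D
  simp only [invOf_eq_nonsing_inv] at hinv
  set L := (A - B * D⁻¹ * Bᵀ)⁻¹
  have htranspose : D⁻¹ * Bᵀ = (B * D⁻¹)ᵀ := by rw [transpose_mul, transpose_nonsing_inv, hDsymm]
  rw [hinv, fromBlocks_mulVec, sumElim_dotProduct_sumElim, htranspose]
  simp only [Sum.elim_comp_inl, Sum.elim_comp_inr, Matrix.mul_assoc L B]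
  rw [Matrix.mul_assoc (_ * L), Matrix.mul_assoc _ L]
  set β := B * D⁻¹
  simp only [neg_mulVec, add_mulVec, ← mulVec_mulVec, dotProduct_add, dotProduct_neg, mulVec_sub,
    dotProduct_sub, sub_dotProduct]
  have hadjoint : ∀ z, y ⬝ᵥ βᵀ *ᵥ z = (β *ᵥ y) ⬝ᵥ z := fun z => by
    rw [dotProduct_mulVec, vecMul_transpose]
  simp only [hadjoint]
  ring

theorem gaussianDensity_fromBlocks {A : Matrix ι ι ℝ} {B : Matrix ι κ ℝ} {D : Matrix κ κ ℝ}
    (hD : D.PosDef) (hL : (A - B * D⁻¹ * Bᵀ).PosDef) (m x : ι ⊕ κ → ℝ) :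
    gaussianDensity m (fromBlocks A B Bᵀ D) x =
      gaussianDensity 0 (A - B * D⁻¹ * Bᵀ)
        ((x - m) ∘ Sum.inl - (B * D⁻¹) *ᵥ ((x - m) ∘ Sum.inr)) *
      gaussianDensity (m ∘ Sum.inr) D (x ∘ Sum.inr) := by
  have hDsymm : Dᵀ = D := by rw [← conjTranspose_eq_transpose_of_trivial]; exact hD.isHermitian
  have hdet : (fromBlocks A B Bᵀ D).det = D.det * (A - B * D⁻¹ * Bᵀ).det := by
    obtain ⟨_⟩ := hD.isUnit.nonempty_invertible
    rw [det_fromBlocks₂₂, invOf_eq_nonsing_inv]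
  have hquad := dotProduct_inv_fromBlocks_mulVec hD.isUnit hDsymm hL.isUnit ((x - m) ∘ Sum.inl)
    ((x - m) ∘ Sum.inr)
  rw [Sum.elim_comp_inl_inr] at hquad
  have hsub : x ∘ Sum.inr - m ∘ Sum.inr = (x - m) ∘ Sum.inr := rfl
  simp only [gaussianDensity, hdet, hquad, Real.sqrt_mul hD.det_pos.le, Fintype.card_sum, pow_add,
    sub_zero, hsub, neg_add, add_div, Real.exp_add, mul_inv]
  ring

end GaussianMarginals

section MarginalDensity

open Matrix

variable {V : Type*}

theorem covMat_map_restrict (p : Measure (V → ℝ)) (A : Finset V) :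
    covMat (p.map (A.restrict (π := fun _ : V => ℝ))) = covBlock p A A := by
  ext i j
  exact covariance_map (measurable_pi_apply i).aestronglyMeasurable
    (measurable_pi_apply j).aestronglyMeasurable (Finset.measurable_restrict A).aemeasurable

theorem integral_map_restrict (p : Measure (V → ℝ)) (A : Finset V) (i : A) :
    ∫ y, y i ∂p.map (A.restrict (π := fun _ : V => ℝ)) = ∫ y, y i ∂p :=
  integral_map (Finset.measurable_restrict A).aemeasurable
    (measurable_pi_apply i).aestronglyMeasurable

instance isGaussian_map_restrict [Finite V] (p : Measure (V → ℝ)) [IsGaussian p] (A : Finset V) :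
    IsGaussian (p.map (A.restrict (π := fun _ : V => ℝ))) := by
  have := Fintype.ofFinite V
  let L : (V → ℝ) →L[ℝ] (A → ℝ) := .pi fun i : A => .proj (i : V)
  exact isGaussian_map (μ := p) L

variable [Fintype V]

theorem quasiMeasurePreserving_restrict (A : Finset V) :
    Measure.QuasiMeasurePreserving (A.restrict (π := fun _ : V => ℝ)) volume volume := by
  classical
  convert Measure.quasiMeasurePreserving_fst.comp
    (volume_preserving_piEquivPiSubtypeProd (fun _ : V => ℝ) (· ∈ A)).quasiMeasurePreserving
  · rfl
  · rfl

theorem rnDeriv_eq_gaussianDensity {ι : Type*} [Fintype ι] [DecidableEq ι] (ν : Measure (ι → ℝ))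
    [IsGaussian ν] (hν : (covMat ν).PosDef) :
    ν.rnDeriv volume =ᵐ[volume] fun x =>
      ENNReal.ofReal (gaussianDensity (fun i => ∫ y, y i ∂ν) (covMat ν) x) := by
  conv_lhs => rw [isGaussian_eq_withDensity ν hν]
  exact Measure.rnDeriv_withDensity _
    (ENNReal.measurable_ofReal.comp (continuous_gaussianDensity _ _).measurable)

variable [DecidableEq V] (p : Measure (V → ℝ)) [IsGaussian p]

theorem margDensity_eq_gaussianDensity (hp : (covMat p).PosDef) (A : Finset V) :
    margDensity p A =ᵐ[volume] fun x =>
      ENNReal.ofReal (gaussianDensity (fun i : A => ∫ y, y i ∂p) (covBlock p A A)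
        (A.restrict x)) := by
  have hA : (covMat (p.map (A.restrict (π := fun _ : V => ℝ)))).PosDef := by
    rw [covMat_map_restrict]
    exact hp.submatrix Subtype.val_injective
  have hae := (quasiMeasurePreserving_restrict A).ae_eq_comp (rnDeriv_eq_gaussianDensity _ hA)
  rw [covMat_map_restrict] at hae
  simp only [integral_map_restrict] at hae
  exact hae

theorem condDensity_eq_gaussianDensity (hp : (covMat p).PosDef) {K P : Finset V}
    (hKP : Disjoint K P) (hL : (condCov p K P).PosDef) :
    condDensity p K P =ᵐ[volume] fun x =>
      ENNReal.ofReal (gaussianDensity 0 (condCov p K P)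
        ((fun i : K => x i - ∫ y, y i ∂p) -
          regCoef p K P *ᵥ fun i : P => x i - ∫ y, y i ∂p)) := by
  have hP : (covBlock p P P).PosDef := hp.submatrix Subtype.val_injective
  filter_upwards [margDensity_eq_gaussianDensity p hp (K ∪ P),
    margDensity_eq_gaussianDensity p hp P] with x hmargKP hmargP
  rw [condDensity, hmargKP, hmargP, ← ENNReal.ofReal_div_of_pos (gaussianDensity_pos _ hP _)]
  congr 1
  rw [div_eq_iff (gaussianDensity_pos _ hP _).ne',
    ← gaussianDensity_comp_equiv (Equiv.Finset.union K P hKP)]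
  have hsymm : covBlock p P K = (covBlock p K P)ᵀ := by
    conv_lhs => rw [covBlock, ← covMat_transpose p]
    rfl
  have hblocks : (covBlock p (K ∪ P) (K ∪ P)).submatrix (Equiv.Finset.union K P hKP)
      (Equiv.Finset.union K P hKP) =
      fromBlocks (covBlock p K K) (covBlock p K P) (covBlock p K P)ᵀ (covBlock p P P) := by
    rw [← hsymm]
    ext i j
    cases i <;> cases j <;> rfl
  rw [condCov, hsymm] at hL ⊢
  rw [hblocks, gaussianDensity_fromBlocks hP hL]
  rfl

end MarginalDensity

section QuadraticForm

open Matrix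

variable {ι : Type*} [Fintype ι]

theorem eq_zero_of_dotProduct_mulVec_self {A : Matrix ι ι ℝ} (hA : Aᵀ = A)
    (h : ∀ z, z ⬝ᵥ A *ᵥ z = 0) : A = 0 := by
  classical
  have hpolar : ∀ u v : ι → ℝ, u ⬝ᵥ A *ᵥ v = 0 := fun u v => by
    have hadd := h (u + v)
    have hcomm : v ⬝ᵥ A *ᵥ u = u ⬝ᵥ A *ᵥ v := by
      rw [dotProduct_mulVec, ← mulVec_transpose, hA, dotProduct_comm]
    simp only [mulVec_add, dotProduct_add, add_dotProduct, h, hcomm] at hadd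
    linarith
  ext i j
  simpa using hpolar (Pi.single i 1) (Pi.single j 1)

theorem eq_of_mul_exp_dotProduct_mulVec_self_eq {A B : Matrix ι ι ℝ} (hA : Aᵀ = A) (hB : Bᵀ = B)
    {c d : ℝ} (hc : c ≠ 0)
    (h : ∀ z, c * Real.exp (-(z ⬝ᵥ A *ᵥ z) / 2) = d * Real.exp (-(z ⬝ᵥ B *ᵥ z) / 2)) :
    A = B := by
  have hcd : c = d := by simpa using h 0
  rw [← sub_eq_zero]
  refine eq_zero_of_dotProduct_mulVec_self (by rw [transpose_sub, hA, hB]) fun z => ?_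
  have hexp := Real.exp_injective (mul_left_cancel₀ hc ((h z).trans (by rw [hcd])))
  rw [sub_mulVec, dotProduct_sub]
  linarith

theorem gaussianDensity_eq_mul_exp [DecidableEq ι] (m : ι → ℝ) (S : Matrix ι ι ℝ) (x : ι → ℝ) :
    gaussianDensity m S x =
      gaussianDensity 0 S 0 * Real.exp (-((x - m) ⬝ᵥ S⁻¹ *ᵥ (x - m)) / 2) := by
  simp [gaussianDensity]

end QuadraticForm

namespace UCG

open Matrix

variable {V : Type*} [Fintype V] [DecidableEq V] {G : UCG V} {p : Measure (V → ℝ)} {K : Finset V}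

/-- The matrix `A` has no nonzero entries between different chain components. -/
def IsBlockDiagonal (G : UCG V) (A : Matrix V V ℝ) : Prop :=
  ∀ i j, j ∉ G.component i → A i j = 0

theorem isBlockDiagonal_iff {A : Matrix V V ℝ} : G.IsBlockDiagonal A ↔ G.blockPart A = A := by
  refine ⟨fun h => ?_, fun h i j hj => ?_⟩
  · ext i j
    by_cases hj : j ∈ G.component i
    · exact blockPart_apply_of_mem hj
    · rw [blockPart_apply_of_not_mem hj, h i j hj]
  · rw [← h, blockPart_apply_of_not_mem hj]

theorem residualMatrix_mulVec_apply (hK : K ∈ G.Cc) (i : K) (z : V → ℝ) :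
    (residualMatrix G p *ᵥ z) i = z i - (regCoef p K (G.Pa K) *ᵥ fun j => z j) i := by
  rw [residualMatrix, sub_mulVec, one_mulVec, Pi.sub_apply, mulVec, mulVec, dotProduct,
    ← Finset.sum_subset (Finset.subset_univ (G.Pa K)) fun j _ hj => by
      rw [parentCoef_eq_zero (by rwa [component_eq hK i.2]), zero_mul], ← Finset.sum_coe_sort]
  simp only [parentCoef_apply hK, dotProduct]

theorem sum_dotProduct_condCov_inv (y : V → ℝ) :
    ∑ K ∈ G.Cc, (fun i : K => y i) ⬝ᵥ (condCov p K (G.Pa K))⁻¹ *ᵥ (fun i : K => y i) =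
      y ⬝ᵥ condPrecision G p *ᵥ y := by
  rw [dotProduct, ← sum_sum_Cc (G := G)]
  refine Finset.sum_congr rfl fun K hK => ?_
  rw [← Finset.sum_coe_sort, dotProduct]
  refine Finset.sum_congr rfl fun i _ => ?_
  rw [mulVec, mulVec, dotProduct, dotProduct,
    ← Finset.sum_subset (Finset.subset_univ K) fun j _ hj => by
      rw [condPrecision_eq_zero (by rwa [component_eq hK i.2]), zero_mul],
    ← Finset.sum_coe_sort K fun j => condPrecision G p i j * y j]
  exact congrArg _ (Finset.sum_congr rfl fun j _ => by rw [condPrecision_apply hK])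

theorem prod_gaussianDensity (y : V → ℝ) :
    ∏ K ∈ G.Cc, gaussianDensity 0 (condCov p K (G.Pa K)) (fun i : K => y i) =
      (∏ K ∈ G.Cc, gaussianDensity 0 (condCov p K (G.Pa K)) 0) *
        Real.exp (-(y ⬝ᵥ condPrecision G p *ᵥ y) / 2) := by
  rw [← sum_dotProduct_condCov_inv, ← Finset.sum_neg_distrib, Finset.sum_div, Real.exp_sum,
    ← Finset.prod_mul_distrib]
  refine Finset.prod_congr rfl fun K _ => ?_
  rw [gaussianDensity_eq_mul_exp, sub_zero]

theorem IsBlockDiagonal.det_eq_prod {A : Matrix V V ℝ} (hA : G.IsBlockDiagonal A) :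
    A.det = ∏ K ∈ G.Cc, (A.submatrix ((↑) : K → V) (↑)).det := by
  let e := Fintype.equivFin (Finset V)
  have htri : A.BlockTriangular (e ∘ G.component) := fun i j hij =>
    hA i j fun h => hij.ne (by simp [component_eq_of_mem h])
  have himage : Finset.univ.image (e ∘ G.component) = G.Cc.image e := by
    rw [← Finset.image_image]
    congr 1
    refine Finset.Subset.antisymm (Finset.image_subset_iff.2 fun v _ => component_mem_Cc v)
      fun K hK => ?_
    obtain ⟨v, -, rfl⟩ := Finset.mem_image.1 hK
    exact Finset.mem_image.2 ⟨v, Finset.mem_univ v, by ext; simp [component]⟩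
  rw [htri.det, himage, Finset.prod_image fun _ _ _ _ h => e.injective h]
  refine Finset.prod_congr rfl fun K hK => ?_
  have hiff : ∀ i, i ∈ K ↔ (e ∘ G.component) i = e K := fun i => by
    rw [Function.comp_apply, e.injective.eq_iff]
    exact ⟨component_eq hK, fun h => h ▸ self_mem_component⟩
  rw [← det_submatrix_equiv_self (Equiv.subtypeEquivRight hiff)]
  rfl

theorem det_covMat_eq_prod (hp : (covMat p).PosDef) (hD : G.IsBlockDiagonal (residualCov G p)) :
    (covMat p).det = ∏ K ∈ G.Cc, (condCov p K (G.Pa K)).det := by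
  have hdet : (residualCov G p).det = (covMat p).det := by
    rw [residualCov, det_mul, det_mul, det_transpose, det_residualMatrix, one_mul, mul_one]
  rw [← hdet, hD.det_eq_prod]
  exact Finset.prod_congr rfl fun K hK => by rw [condCov_eq_submatrix hp hK]

theorem gaussianDensity_zero_eq_prod (hp : (covMat p).PosDef)
    (hD : G.IsBlockDiagonal (residualCov G p)) :
    gaussianDensity 0 (covMat p) 0 = ∏ K ∈ G.Cc, gaussianDensity 0 (condCov p K (G.Pa K)) 0 := by
  have hcard : Fintype.card V = ∑ K ∈ G.Cc, Fintype.card K := by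
    simp only [Fintype.card_coe, Finset.card_eq_sum_ones, sum_sum_Cc]
    simp
  have hsqrt : √(∏ K ∈ G.Cc, (condCov p K (G.Pa K)).det) =
      ∏ K ∈ G.Cc, √(condCov p K (G.Pa K)).det :=
    Real.sqrt_prod _ fun K hK => (posDef_condCov hp hK).det_pos.le
  simp [gaussianDensity, det_covMat_eq_prod hp hD, hcard, Finset.prod_mul_distrib,
    Finset.prod_pow_eq_pow_sum, hsqrt]

theorem covMat_inv_eq_iff (hp : (covMat p).PosDef) :
    (covMat p)⁻¹ = (residualMatrix G p)ᵀ * condPrecision G p * residualMatrix G p ↔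
      G.IsBlockDiagonal (residualCov G p) := by
  have hblock := blockPart_residualCov_mul_condPrecision (G := G) hp
  calc (covMat p)⁻¹ = (residualMatrix G p)ᵀ * condPrecision G p * residualMatrix G p
      ↔ (residualMatrix G p)ᵀ * condPrecision G p * residualMatrix G p * covMat p = 1 :=
        ⟨fun h => by rw [← h, nonsing_inv_mul _ hp.det_pos.ne'.isUnit], inv_eq_left_inv⟩
    _ ↔ condPrecision G p * residualCov G p = 1 := by
        rw [residualCov, Matrix.mul_assoc, Matrix.mul_assoc, mul_eq_one_comm]
        simp only [Matrix.mul_assoc]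
    _ ↔ G.blockPart (residualCov G p) = residualCov G p := by
        refine ⟨fun h => ?_, fun h => mul_eq_one_comm.1 (h ▸ hblock)⟩
        rw [← Matrix.mul_one (G.blockPart _), ← h, ← Matrix.mul_assoc, hblock, Matrix.one_mul]
    _ ↔ G.IsBlockDiagonal (residualCov G p) := isBlockDiagonal_iff.symm

section Factorization

variable [IsGaussian p]

theorem condDensity_Pa_ae_eq (hp : (covMat p).PosDef) (hK : K ∈ G.Cc) :
    condDensity p K (G.Pa K) =ᵐ[volume] fun x => ENNReal.ofReal
      (gaussianDensity 0 (condCov p K (G.Pa K)) fun i : K =>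
        (residualMatrix G p *ᵥ (x - fun i => ∫ y, y i ∂p)) i) := by
  filter_upwards [condDensity_eq_gaussianDensity p hp (disjoint_Pa hK) (posDef_condCov hp hK)]
    with x hx
  rw [hx]
  simp only [residualMatrix_mulVec_apply hK]
  rfl

theorem prod_condDensity_ae_eq (hp : (covMat p).PosDef) :
    (fun x => ∏ K ∈ G.Cc, condDensity p K (G.Pa K) x) =ᵐ[volume] fun x =>
      ENNReal.ofReal ((∏ K ∈ G.Cc, gaussianDensity 0 (condCov p K (G.Pa K)) 0) *
        Real.exp (-((x - fun i => ∫ y, y i ∂p) ⬝ᵥ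
          ((residualMatrix G p)ᵀ * condPrecision G p * residualMatrix G p) *ᵥ
            (x - fun i => ∫ y, y i ∂p)) / 2)) := by
  filter_upwards [(Filter.eventually_all_finset G.Cc).2 fun K => condDensity_Pa_ae_eq hp]
    with x hx
  rw [Finset.prod_congr rfl hx, ← ENNReal.ofReal_prod_of_nonneg fun K hK =>
      (gaussianDensity_pos _ (posDef_condCov hp hK) _).le, prod_gaussianDensity, ← mulVec_mulVec,
    ← mulVec_mulVec, dotProduct_mulVec _ (residualMatrix G p)ᵀ, vecMul_transpose]

theorem factorizes_iff_forall (hp : (covMat p).PosDef) :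
    Factorizes p G ↔ ∀ z : V → ℝ,
      gaussianDensity 0 (covMat p) 0 * Real.exp (-(z ⬝ᵥ (covMat p)⁻¹ *ᵥ z) / 2) =
        (∏ K ∈ G.Cc, gaussianDensity 0 (condCov p K (G.Pa K)) 0) *
          Real.exp (-(z ⬝ᵥ ((residualMatrix G p)ᵀ * condPrecision G p * residualMatrix G p) *ᵥ z) /
            2) := by
  have hleft := rnDeriv_eq_gaussianDensity p hp
  have hright := prod_condDensity_ae_eq (G := G) hp
  have hc := gaussianDensity_pos 0 hp 0
  have hd : 0 < ∏ K ∈ G.Cc, gaussianDensity 0 (condCov p K (G.Pa K)) 0 :=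
    Finset.prod_pos fun K hK => gaussianDensity_pos _ (posDef_condCov hp hK) _
  simp only [gaussianDensity_eq_mul_exp (fun i => ∫ y, y i ∂p)] at hleft
  refine ⟨fun h z => ?_, fun h => (hleft.trans (.of_eq ?_)).trans hright.symm⟩
  · have hcont : ∀ (c : ℝ) (A : Matrix V V ℝ), Continuous fun x : V → ℝ =>
        ENNReal.ofReal (c * Real.exp
          (-((x - fun i => ∫ y, y i ∂p) ⬝ᵥ A *ᵥ (x - fun i => ∫ y, y i ∂p)) / 2)) := fun c A => by
      refine ENNReal.continuous_ofReal.comp ?_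
      simp only [dotProduct, mulVec]
      fun_prop
    have heq := ((hcont _ _).ae_eq_iff_eq volume (hcont _ _)).1
      ((hleft.symm.trans h).trans hright)
    have hz := congrFun heq (z + fun i => ∫ y, y i ∂p)
    rw [add_sub_cancel_right] at hz
    exact (ENNReal.ofReal_eq_ofReal_iff (by positivity) (by positivity)).1 hz
  · ext x
    rw [h]

theorem factorizes_iff (hp : (covMat p).PosDef) :
    Factorizes p G ↔ G.IsBlockDiagonal (residualCov G p) := by
  rw [factorizes_iff_forall hp]
  constructor
  · intro h
    refine (covMat_inv_eq_iff hp).1 (eq_of_mul_exp_dotProduct_mulVec_self_eq ?_ ?_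
      (gaussianDensity_pos 0 hp 0).ne' h)
    · rw [transpose_nonsing_inv, covMat_transpose]
    · rw [transpose_mul, transpose_mul, transpose_transpose, condPrecision_transpose hp,
        Matrix.mul_assoc]
  · intro hD z
    rw [gaussianDensity_zero_eq_prod hp hD, (covMat_inv_eq_iff hp).2 hD]

end Factorization

end UCG

namespace UCG

open Matrix

variable {V : Type*} [Fintype V] [DecidableEq V] {G : UCG V} {p : Measure (V → ℝ)} {i j v : V}

section FactorizationToMarkov

/-- The coefficients of the mothers in the regressions of the chain components on their parents. -/
noncomputable def motherCoef (G : UCG V) (p : Measure (V → ℝ)) : Matrix V V ℝ :=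
  of fun i j => if j ∈ G.Mo (G.component i) then parentCoef G p i j else 0

/-- The coefficients of the fathers in the regressions of the chain components on their parents. -/
noncomputable def fatherCoef (G : UCG V) (p : Measure (V → ℝ)) : Matrix V V ℝ :=
  of fun i j => if j ∈ G.Fa (G.component i) then parentCoef G p i j else 0

theorem fatherCoef_apply_of_mem (h : j ∈ G.Fa (G.component i)) :
    fatherCoef G p i j = parentCoef G p i j := if_pos h

theorem fatherCoef_apply_of_not_mem (h : j ∉ G.Fa (G.component i)) : fatherCoef G p i j = 0 :=
  if_neg h

theorem parentCoef_eq_add : parentCoef G p = motherCoef G p + fatherCoef G p := by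
  ext i j
  rw [Matrix.add_apply, motherCoef, of_apply]
  by_cases hFa : j ∈ G.Fa (G.component i)
  · rw [fatherCoef_apply_of_mem hFa, if_neg (not_mem_Mo_of_mem_Fa (component_mem_Cc i) hFa),
      zero_add]
  · rw [fatherCoef_apply_of_not_mem hFa, add_zero]
    split_ifs with hMo
    · rfl
    · exact parentCoef_eq_zero (Finset.notMem_union.2 ⟨hFa, hMo⟩)

theorem dashed_of_motherCoef_ne_zero (h : ZeroMothers p G) (hij : motherCoef G p i j ≠ 0) :
    G.dashed j i := by
  contrapose! hij
  rw [motherCoef, of_apply, ite_eq_right_iff]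
  intro hj
  rw [parentCoef_apply (component_mem_Cc i) ⟨i, self_mem_component⟩
    ⟨j, Finset.mem_union_right _ hj⟩]
  exact h _ (component_mem_Cc i) _ _ (Finset.mem_sdiff.2 ⟨hj, by simpa [mem_Mo] using hij⟩)

theorem eq_or_und_of_condPrecision_ne_zero (h : ZeroNeighbours p G)
    (hij : condPrecision G p i j ≠ 0) : i = j ∨ G.und.Adj i j := by
  have hj : j ∈ G.component i := not_imp_comm.1 condPrecision_eq_zero hij
  contrapose! hij
  rw [condPrecision_apply (component_mem_Cc i) ⟨i, self_mem_component⟩ ⟨j, hj⟩]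
  refine h _ (component_mem_Cc i) _ _ (Subtype.coe_ne_coe.1 hij.1) (Finset.mem_sdiff.2 ⟨hj, ?_⟩)
  simpa [mem_Ne, SimpleGraph.adj_comm] using hij.2

theorem condPrecision_mul_fatherCoef_apply (hj : j ∈ G.Fa (G.component i)) :
    (condPrecision G p * fatherCoef G p) i j = -(condPrecision G p * residualMatrix G p) i j := by
  have hjPa : j ∈ G.Pa (G.component i) := Finset.mem_union_left _ hj
  rw [mul_apply, mul_apply, ← Finset.sum_neg_distrib]
  refine Finset.sum_congr rfl fun k _ => ?_
  by_cases hk : k ∈ G.component i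
  · have hkj : k ≠ j := by
      rintro rfl
      exact Finset.disjoint_left.1 (disjoint_Pa (component_mem_Cc i)) hk hjPa
    rw [fatherCoef_apply_of_mem (by rwa [component_eq_of_mem hk]), residualMatrix,
      Matrix.sub_apply, one_apply_ne hkj, zero_sub, mul_neg, neg_neg]
  · rw [condPrecision_eq_zero hk, zero_mul, zero_mul, neg_zero]

theorem condPrecision_mul_fatherCoef_eq_zero (hj : j ∉ G.Fa (G.component i)) :
    (condPrecision G p * fatherCoef G p) i j = 0 := by
  rw [mul_apply]
  refine Finset.sum_eq_zero fun k _ => ?_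
  by_cases hk : k ∈ G.component i
  · rw [fatherCoef_apply_of_not_mem (by rwa [component_eq_of_mem hk]), mul_zero]
  · rw [condPrecision_eq_zero hk, zero_mul]

theorem solid_of_condPrecision_mul_fatherCoef_ne_zero (hp : (covMat p).PosDef)
    (h : ZeroFathers p G) (hij : (condPrecision G p * fatherCoef G p) i j ≠ 0) :
    G.solid j i := by
  have hj : j ∈ G.Fa (G.component i) := not_imp_comm.1 condPrecision_mul_fatherCoef_eq_zero hij
  contrapose! hij
  rw [condPrecision_mul_fatherCoef_apply hj, neg_eq_zero,
    ← margPrecision_apply hp (component_mem_Cc i) ⟨i, Finset.mem_union_left _ self_mem_component⟩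
      ⟨j, Finset.mem_union_right _ (Finset.mem_union_left _ hj)⟩ self_mem_component]
  exact h _ (component_mem_Cc i) _ _ self_mem_component
    (Finset.mem_sdiff.2 ⟨hj, by simpa [mem_Fa] using hij⟩)

theorem isParametrization (hp : (covMat p).PosDef) (hD : G.IsBlockDiagonal (residualCov G p))
    (hMo : ZeroMothers p G) (hFa : ZeroFathers p G) (hNe : ZeroNeighbours p G) :
    G.IsParametrization (covMat p) (condPrecision G p) (motherCoef G p)
      (condPrecision G p * fatherCoef G p) := by
  have hinv : residualCov G p * condPrecision G p = 1 := by
    rw [← isBlockDiagonal_iff.1 hD, blockPart_residualCov_mul_condPrecision hp]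
  have hres : condPrecision G p * (1 - motherCoef G p) - condPrecision G p * fatherCoef G p =
      condPrecision G p * residualMatrix G p := by
    rw [← Matrix.mul_sub, residualMatrix, parentCoef_eq_add, sub_sub]
  refine ⟨fun i j => eq_or_und_of_condPrecision_ne_zero hNe,
    fun i j => dashed_of_motherCoef_ne_zero hMo,
    fun i j => solid_of_condPrecision_mul_fatherCoef_ne_zero hp hFa, ?_, ?_⟩
  · rw [← inv_eq_right_inv hinv]
    exact (posDef_residualCov hp).inv
  · calc _ = condPrecision G p * (residualCov G p * condPrecision G p) := by
          rw [hres, transpose_mul, condPrecision_transpose hp, residualCov]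
          simp only [Matrix.mul_assoc]
      _ = condPrecision G p := by rw [hinv, Matrix.mul_one]

theorem globalMarkov_of_factorizes [IsGaussian p] (hp : (covMat p).PosDef)
    (hfact : Factorizes p G) (hMo : ZeroMothers p G) (hFa : ZeroFathers p G)
    (hNe : ZeroNeighbours p G) : GlobalMarkov p G := by
  have hparam := isParametrization hp ((factorizes_iff hp).1 hfact) hMo hFa hNe
  intro X Y Z _ hXZ _ hsep
  exact (condIndepCoords_iff hp hXZ).2 fun x hx y hy =>
    hparam.exists_isResidual_of_separated hp hsep hx hy (Finset.disjoint_left.1 hXZ hx)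

end FactorizationToMarkov

section StrictDescendant

variable {K : Finset V}

theorem StrictDescendant.of_mem_Pa (hv : v ∈ G.Pa (G.component i))
    (h : v ∈ K ∨ G.StrictDescendant K v) : G.StrictDescendant K i := by
  obtain ⟨c, hc, hvc⟩ := mem_Pa.1 hv
  exact (h.elim hvc.strictDescendant (·.arrow hvc)).reachable (mem_component.1 hc).symm

end StrictDescendant

section MarkovToFactorization

variable [IsGaussian p]

theorem covMat_mulVec_residualMatrix_eq_zero (hp : (covMat p).PosDef) (h : GlobalMarkov p G)
    (hv : v ∉ G.component i) (hvd : ¬ G.StrictDescendant (G.component i) v) :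
    (covMat p *ᵥ residualMatrix G p i) v = 0 := by
  have hK := component_mem_Cc (G := G) i
  have hres := isResidual_residualMatrix (G := G) hp i
  by_cases hvPa : v ∈ G.Pa (G.component i)
  · exact hres.mulVec_eq_zero v hvPa
  · have hsep : G.Separated (G.component i) {v} (G.Pa (G.component i)) :=
      separated_Pa hK fun y hy => Finset.mem_singleton.1 hy ▸ ⟨hv, hvd⟩
    obtain ⟨a, ha, hav⟩ := h.exists_isResidual hp (Finset.disjoint_singleton_right.2 hv)
      (disjoint_Pa hK) (Finset.disjoint_singleton_left.2 hvPa) hsep self_mem_component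
      (Finset.mem_singleton_self v)
    rwa [← ha.eq hp hres]

theorem residualCov_eq_zero (hp : (covMat p).PosDef) (h : GlobalMarkov p G)
    (hj : j ∉ G.component i) (hd : ¬ G.StrictDescendant (G.component j) i) :
    residualCov G p i j = 0 := by
  have hi := isResidual_residualMatrix (G := G) hp i
  rw [residualCov_apply, hi.dotProduct_eq (not_mem_Pa_component i),
    covMat_mulVec_residualMatrix_eq_zero hp h (fun h => hj (mem_component_comm.1 h)) hd, zero_add]
  refine Finset.sum_eq_zero fun v _ => ?_
  rw [covMat_mulVec_residualMatrix_eq_zero hp h (fun hv => hd (.of_mem_Pa v.2 (.inl hv)))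
    fun hv => hd (.of_mem_Pa v.2 (.inr hv)), mul_zero]

theorem factorizes_of_globalMarkov (hp : (covMat p).PosDef) (h : GlobalMarkov p G) :
    Factorizes p G := by
  rw [factorizes_iff hp]
  intro i j hj
  by_cases hd : G.StrictDescendant (G.component j) i
  · rw [residualCov_comm]
    exact residualCov_eq_zero hp h (fun hi => hj (mem_component_comm.1 hi)) hd.not_symm
  · exact residualCov_eq_zero hp h hj hd

theorem zeroMothers_of_globalMarkov (hp : (covMat p).PosDef) (h : GlobalMarkov p G) :
    ZeroMothers p G := by
  rintro K hK ⟨i, hi⟩ ⟨j, hjPa⟩ hj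
  obtain ⟨hjMo, hji⟩ : j ∈ G.Mo K ∧ ¬ G.dashed j i := by simpa [mem_Mo (X := {_})] using hj
  have hiPa : i ∉ G.Pa K := Finset.disjoint_left.1 (disjoint_Pa hK) hi
  have hij : i ≠ j := by
    rintro rfl
    exact hiPa hjPa
  obtain ⟨a, ha, haj⟩ := h.exists_isResidual hp (Finset.disjoint_singleton.2 hij)
    (by simp [hiPa]) (by simp) (separated_mother hK hi hjMo hji) (Finset.mem_singleton_self i)
    (Finset.mem_singleton_self j)
  rw [(ha.of_sdiff_singleton haj).regCoef_eq hp ⟨i, hi⟩ ⟨j, hjPa⟩ hiPa,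
    ha.apply_eq_zero j hij.symm (by simp), neg_zero]

theorem margPrecision_eq_zero_of_globalMarkov (hp : (covMat p).PosDef) (h : GlobalMarkov p G)
    {K : Finset V} (hK : K ∈ G.Cc) {i j : (K ∪ G.Pa K : Finset V)} (hi : (i : V) ∈ K)
    (hij : i ≠ j) (hund : ¬ G.und.Adj i j) (hsolid : ¬ G.solid j i) (hjMo : (j : V) ∉ G.Mo K) :
    margPrecision p (K ∪ G.Pa K) i j = 0 := by
  have hne : (i : V) ≠ j := Subtype.coe_ne_coe.2 hij
  obtain ⟨a, ha, haj⟩ := h.exists_isResidual hp (Finset.disjoint_singleton.2 hne) (by simp)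
    (by simp) (separated_nonadjacent hK hi j.2 hne hund hsolid hjMo)
    (Finset.mem_singleton_self _) (Finset.mem_singleton_self _)
  exact ha.margPrecision_eq_zero hp hij haj

theorem zeroFathers_of_globalMarkov (hp : (covMat p).PosDef) (h : GlobalMarkov p G) :
    ZeroFathers p G := by
  intro K hK i j hi hj
  obtain ⟨hjFa, hji⟩ : (j : V) ∈ G.Fa K ∧ ¬ G.solid j i := by simpa [mem_Fa (X := {_})] using hj
  have hjK : (j : V) ∉ K := fun hjK =>
    Finset.disjoint_left.1 (disjoint_Pa hK) hjK (Finset.mem_union_left _ hjFa)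
  exact margPrecision_eq_zero_of_globalMarkov hp h hK hi (fun hij => hjK (hij ▸ hi))
    (fun hund => hjK (mem_of_und hK hi hund)) hji (not_mem_Mo_of_mem_Fa hK hjFa)

theorem zeroNeighbours_of_globalMarkov (hp : (covMat p).PosDef) (h : GlobalMarkov p G) :
    ZeroNeighbours p G := by
  rintro K hK ⟨i, hi⟩ ⟨j, hjK⟩ hij hj
  have hund : ¬ G.und.Adj i j := by
    simpa [mem_Ne (X := {_}), hjK, SimpleGraph.adj_comm] using hj
  have hsolid : ¬ G.solid j i := fun hji =>
    not_strictDescendant_of_mem hK hi (Arrow.strictDescendant (.inl hji) hjK)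
  have hjMo : j ∉ G.Mo K := fun hjMo =>
    Finset.disjoint_left.1 (disjoint_Pa hK) hjK (Finset.mem_union_right _ hjMo)
  have hprec := margPrecision_eq_zero_of_globalMarkov hp h hK
    (i := ⟨i, Finset.mem_union_left _ hi⟩) (j := ⟨j, Finset.mem_union_left _ hjK⟩) hi
    (fun h => hij (Subtype.ext (Subtype.mk.inj h))) hund hsolid hjMo
  rwa [margPrecision_apply hp hK _ _ hi,
    condPrecision_mul_residualMatrix_apply (by rwa [component_eq hK hi]),
    condPrecision_apply hK ⟨i, hi⟩ ⟨j, hjK⟩] at hprec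

end MarkovToFactorization

end UCG

theorem mainTheorem2 {V : Type*} [Fintype V] [DecidableEq V] (G : UCG V)
    (p : Measure (V → ℝ)) [IsGaussian p] (hp : (covMat p).PosDef) :
    (Factorizes p G ∧ ZeroMothers p G ∧ ZeroFathers p G ∧ ZeroNeighbours p G) ↔
      GlobalMarkov p G := by
  constructor
  · rintro ⟨hfact, hMo, hFa, hNe⟩
    exact UCG.globalMarkov_of_factorizes hp hfact hMo hFa hNe
  · intro h
    exact ⟨UCG.factorizes_of_globalMarkov hp h, UCG.zeroMothers_of_globalMarkov hp h,
      UCG.zeroFathers_of_globalMarkov hp h, UCG.zeroNeighbours_of_globalMarkov hp h⟩
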